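/- All Hilbert spaces are finite-dimensional and a state is a positive semidefinite operator of trace $1$. For a bipartite state $\rho$ on $\mathcal H^{AB}$ let $E_{\mathrm r}(\rho)=\min_{\sigma\in\mathcal S}S(\rho\|\sigma)$ be the relative entropy of entanglement, where $\mathcal S$ is the set of separable states and $S(\rho\|\sigma)=\mathrm{Tr}(\rho\log_2\rho)-\mathrm{Tr}(\rho\log_2\sigma)$ (equal to $+\infty$ if the support of $\rho$ is not contained in that of $\sigma$), and let $E_\infty(\rho)=\lim_{n\to\infty}E_{\mathrm r}(\rho^{\otimes n})/n$. A quantum operation (completely positive trace-preserving linear map) $\Lambda$ between bipartite systems is $\varepsilon$-entanglement-nonincreasing if $E_{\mathrm r}(\Lambda[\tau])-E_{\mathrm r}(\tau)\le\varepsilon$ for all input states $\tau$. A state $\rho$ can be converted into $\sigma$ with rate $r\ge 0$ via asymptotically entanglement-nonincreasing (AEN) operations if there is a sequence of quantum operations $\Lambda_n$, from $n$ copies of the system of $\rho$ to $\lfloor rn\rfloor$ copies of the system of $\sigma$, such that for all $\varepsilon>0$, $\delta>0$ and $N$ there is $n\ge N$ for which $\Lambda_n$ is $\varepsilon$-entanglement-nonincreasing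 and $\|\Lambda_n[\rho^{\otimes n}]-\sigma^{\otimes\lfloor rn\rfloor}\|_1<\delta$. Let $R_{\mathrm{AEN}}(\rho\to\sigma)$ be the supremum of these rates. For multipartite states and a bipartition $T|\overline T$ of the parties ($T$ a nonempty proper subset), $E_{\mathrm r}^{T|\overline T}$ and $E_\infty^{T|\overline T}$ denote these quantities across the cut. The multipartite rate $R_{\mathrm{AEN}}$ is defined in the same way, with $\Lambda_n$ required to be $\varepsilon$-entanglement-nonincreasing in every bipartition. Proposition. (0) The limit defining $E_\infty(\rho)$ exists and lies in $[0,\infty)$ for every bipartite state $\rho$; likewise $E_\infty^{T|\overline T}(\rho)$ for every multipartite state $\rho$ and every bipartition. (1) For any bipartite states $\rho$ and $\sigma$ with $E_\infty(\sigma)>0$, $$R_{\mathrm{AEN}}(\rho\to\sigma)\le\frac{E_\infty(\rho)}{E_\infty(\sigma)}.$$ (2) For any bipartite state $\rho$ and the singlet $|\psi^-\rangle=(|01\rangle-|10\rangle)/\sqrt2$, $R_{\mathrm{AEN}}(\rho\to\psi^-)\le E_\infty(\rho)$. (3) For any multipartite states $\rho$ and $\sigma$ of the same set of parties, $$R_{\mathrm{AEN}}(\rho\to\sigma)\le\min_T\frac{E_\infty^{T|\overline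 T}(\rho)}{E_\infty^{T|\overline T}(\sigma)},$$ where the minimum is over the bipartitions $T|\overline T$ with $E_\infty^{T|\overline T}(\sigma)>0$ (and is $+\infty$ if there are none). -/

import Mathlib

open Filter Topology
open scoped NNReal Kronecker Matrix ComplexOrder

noncomputable section

namespace AEN

section General

variable {I J : Type*} [Fintype I] [DecidableEq I] [Fintype J] [DecidableEq J]

/-- Quantum states (density matrices) on the Hilbert space with orthonormal basis `I`. -/
def IsState (ρ : Matrix I I ℂ) : Prop := ρ.PosSemidef ∧ ρ.trace = 1

/-- The ampliation `Λ ⊗ id` of a linear map to matrices with an ancilla of dimension `k`. -/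
def ampliate (Λ : Matrix I I ℂ →ₗ[ℂ] Matrix J J ℂ) (k : ℕ)
    (X : Matrix (I × Fin k) (I × Fin k) ℂ) : Matrix (J × Fin k) (J × Fin k) ℂ :=
  Matrix.of fun x y => Λ (Matrix.of fun i i' => X (i, x.2) (i', y.2)) x.1 y.1

/-- Quantum operations: completely positive trace-preserving linear maps. -/
def IsChannel (Λ : Matrix I I ℂ →ₗ[ℂ] Matrix J J ℂ) : Prop :=
  (∀ (k : ℕ) (X : Matrix (I × Fin k) (I × Fin k) ℂ), X.PosSemidef → (ampliate Λ k X).PosSemidef) ∧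
    ∀ X : Matrix I I ℂ, (Λ X).trace = X.trace

/-- Trace norm `‖M‖₁ = Tr √(M† M)`. -/
def traceNorm (M : Matrix I I ℂ) : ℝ := (cfc Real.sqrt (Mᴴ * M)).trace.re

open Classical in
/-- Quantum relative entropy `S(ρ‖σ) = Tr(ρ log₂ ρ) - Tr(ρ log₂ σ)`, equal to `+∞` unless the
support of `ρ` is contained in the support of `σ` (that is, `ker σ ⊆ ker ρ`). The convention
`Real.logb 2 0 = 0` makes the logarithms act on the supports only. -/
def relEntropy (ρ σ : Matrix I I ℂ) : EReal :=
  if ∀ v : I → ℂ, σ *ᵥ v = 0 → ρ *ᵥ v = 0 then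
    (((ρ * cfc (Real.logb 2) ρ).trace - (ρ * cfc (Real.logb 2) σ).trace).re : ℝ)
  else ⊤

end General

section Bipartite

variable {A B A' B' : Type*} [Fintype A] [DecidableEq A] [Fintype B] [DecidableEq B]
  [Fintype A'] [DecidableEq A'] [Fintype B'] [DecidableEq B']

/-- Separable states: finite convex combinations of product states. -/
def IsSeparable (ρ : Matrix (A × B) (A × B) ℂ) : Prop :=
  ρ ∈ convexHull ℝ {τ : Matrix (A × B) (A × B) ℂ |
    ∃ (α : Matrix A A ℂ) (β : Matrix B B ℂ), IsState α ∧ IsState β ∧ τ = α ⊗ₖ β}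

/-- Relative entropy of entanglement `E_r(ρ)`. -/
def relEntEntanglement (ρ : Matrix (A × B) (A × B) ℂ) : EReal :=
  ⨅ (σ : Matrix (A × B) (A × B) ℂ) (_ : IsSeparable σ), relEntropy ρ σ

/-- `ρ^{⊗n}` as a bipartite state: the first party holds all `A` systems, the second all `B`
systems. -/
def tensorPower (ρ : Matrix (A × B) (A × B) ℂ) (n : ℕ) :
    Matrix ((Fin n → A) × (Fin n → B)) ((Fin n → A) × (Fin n → B)) ℂ :=
  Matrix.of fun x y => ∏ k, ρ (x.1 k, x.2 k) (y.1 k, y.2 k)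

/-- The sequence `E_r(ρ^{⊗n}) / n`. -/
def entanglementPerCopy (ρ : Matrix (A × B) (A × B) ℂ) (n : ℕ) : EReal :=
  relEntEntanglement (tensorPower ρ n) / (n : EReal)

/-- Regularized relative entropy of entanglement `E_∞(ρ) = lim E_r(ρ^{⊗n}) / n`. -/
def regRelEnt (ρ : Matrix (A × B) (A × B) ℂ) : EReal :=
  limUnder atTop (entanglementPerCopy ρ)

/-- `ε`-entanglement-nonincreasing maps: `E_r(Λ[ρ]) - E_r(ρ) ≤ ε` for all states `ρ`. -/
def IsNonincreasing (ε : ℝ) (Λ : Matrix (A × B) (A × B) ℂ →ₗ[ℂ] Matrix (A' × B') (A' × B') ℂ) :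
    Prop :=
  ∀ ρ : Matrix (A × B) (A × B) ℂ, IsState ρ →
    relEntEntanglement (Λ ρ) ≤ relEntEntanglement ρ + (ε : EReal)

/-- `ρ` can be converted into `σ` with rate `r` via asymptotically entanglement-nonincreasing
operations. -/
def IsAchievable (ρ : Matrix (A × B) (A × B) ℂ) (σ : Matrix (A' × B') (A' × B') ℂ) (r : ℝ≥0) :
    Prop :=
  ∃ Λ : (n : ℕ) → Matrix ((Fin n → A) × (Fin n → B)) ((Fin n → A) × (Fin n → B)) ℂ →ₗ[ℂ]
      Matrix ((Fin ⌊r * n⌋₊ → A') × (Fin ⌊r * n⌋₊ → B'))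
        ((Fin ⌊r * n⌋₊ → A') × (Fin ⌊r * n⌋₊ → B')) ℂ,
    (∀ n, IsChannel (Λ n)) ∧
    ∀ ε : ℝ, 0 < ε → ∀ δ : ℝ, 0 < δ → ∀ N : ℕ, ∃ n ≥ N,
      IsNonincreasing ε (Λ n) ∧
      traceNorm (Λ n (tensorPower ρ n) - tensorPower σ ⌊r * n⌋₊) < δ

/-- The conversion rate `R_AEN(ρ → σ)`: the supremum, in `[0, ∞]`, of all achievable rates. -/
def rate (ρ : Matrix (A × B) (A × B) ℂ) (σ : Matrix (A' × B') (A' × B') ℂ) : EReal :=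
  ⨆ (r : ℝ≥0) (_ : IsAchievable ρ σ r), ((r : ℝ) : EReal)

end Bipartite

/-- The singlet vector `(|01⟩ - |10⟩)/√2`. -/
def singletVec : Fin 2 × Fin 2 → ℂ :=
  fun x => if x = (0, 1) then 1 / (√2 : ℝ) else if x = (1, 0) then -(1 / (√2 : ℝ)) else 0

/-- The singlet state `|ψ⁻⟩⟨ψ⁻|`. -/
def singlet : Matrix (Fin 2 × Fin 2) (Fin 2 × Fin 2) ℂ :=
  Matrix.vecMulVec singletVec (star singletVec)

section Multipartite

variable {ι : Type*} [Fintype ι] [DecidableEq ι]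
  {X : ι → Type*} [∀ p, Fintype (X p)] [∀ p, DecidableEq (X p)]
  {Y : ι → Type*} [∀ p, Fintype (Y p)] [∀ p, DecidableEq (Y p)]

/-- A multipartite operator (party `p` holds the system `X p`) viewed as a bipartite one across the
cut `T | Tᶜ`. -/
def cut (T : Finset ι) (ρ : Matrix (∀ p, X p) (∀ p, X p) ℂ) :
    Matrix ((∀ p : {p // p ∈ T}, X p) × (∀ p : {p // p ∉ T}, X p))
      ((∀ p : {p // p ∈ T}, X p) × (∀ p : {p // p ∉ T}, X p)) ℂ :=
  ρ.reindex (Equiv.piEquivPiSubtypeProd (· ∈ T) X) (Equiv.piEquivPiSubtypeProd (· ∈ T) X)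

/-- `E_r` across the cut `T | Tᶜ`. -/
def cutRelEnt (T : Finset ι) (ρ : Matrix (∀ p, X p) (∀ p, X p) ℂ) : EReal :=
  relEntEntanglement (cut T ρ)

/-- `ρ^{⊗n}` as a multipartite state: party `p` holds `n` copies of `X p`. -/
def multiTensorPower (ρ : Matrix (∀ p, X p) (∀ p, X p) ℂ) (n : ℕ) :
    Matrix (∀ p, Fin n → X p) (∀ p, Fin n → X p) ℂ :=
  Matrix.of fun x y => ∏ k, ρ (fun p => x p k) (fun p => y p k)

/-- The sequence `E_r(ρ^{⊗n}) / n` across the cut `T | Tᶜ`. -/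
def cutEntanglementPerCopy (T : Finset ι) (ρ : Matrix (∀ p, X p) (∀ p, X p) ℂ) (n : ℕ) : EReal :=
  cutRelEnt T (multiTensorPower ρ n) / (n : EReal)

/-- `E_∞` across the cut `T | Tᶜ`. -/
def cutRegRelEnt (T : Finset ι) (ρ : Matrix (∀ p, X p) (∀ p, X p) ℂ) : EReal :=
  limUnder atTop (cutEntanglementPerCopy T ρ)

/-- Maps that are `ε`-entanglement-nonincreasing in every bipartition. -/
def IsMultiNonincreasing (ε : ℝ)
    (Λ : Matrix (∀ p, X p) (∀ p, X p) ℂ →ₗ[ℂ] Matrix (∀ p, Y p) (∀ p, Y p) ℂ) : Prop :=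
  ∀ T : Finset ι, T.Nonempty → T ≠ Finset.univ →
    ∀ ρ : Matrix (∀ p, X p) (∀ p, X p) ℂ, IsState ρ →
      cutRelEnt T (Λ ρ) ≤ cutRelEnt T ρ + (ε : EReal)

/-- `ρ` can be converted into `σ` with rate `r` via multipartite asymptotically
entanglement-nonincreasing operations. -/
def IsMultiAchievable (ρ : Matrix (∀ p, X p) (∀ p, X p) ℂ) (σ : Matrix (∀ p, Y p) (∀ p, Y p) ℂ)
    (r : ℝ≥0) : Prop :=
  ∃ Λ : (n : ℕ) → Matrix (∀ p, Fin n → X p) (∀ p, Fin n → X p) ℂ →ₗ[ℂ]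
      Matrix (∀ p, Fin ⌊r * n⌋₊ → Y p) (∀ p, Fin ⌊r * n⌋₊ → Y p) ℂ,
    (∀ n, IsChannel (Λ n)) ∧
    ∀ ε : ℝ, 0 < ε → ∀ δ : ℝ, 0 < δ → ∀ N : ℕ, ∃ n ≥ N,
      IsMultiNonincreasing ε (Λ n) ∧
      traceNorm (Λ n (multiTensorPower ρ n) - multiTensorPower σ ⌊r * n⌋₊) < δ

/-- The multipartite conversion rate `R_AEN(ρ → σ)`. -/
def multiRate (ρ : Matrix (∀ p, X p) (∀ p, X p) ℂ) (σ : Matrix (∀ p, Y p) (∀ p, Y p) ℂ) : EReal :=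
  ⨆ (r : ℝ≥0) (_ : IsMultiAchievable ρ σ r), ((r : ℝ) : EReal)

end Multipartite

end AEN

end

set_option linter.unusedSectionVars false

/-! Let `m = ⌊r * n⌋₊`. If `Λ n` takes `ρ^{⊗n}` to within `δ` of `σ^{⊗m}` and raises `E_r` by at
most `1`, then asymptotic continuity of `E_r` gives `E_r(σ^{⊗m}) ≤ E_r(ρ^{⊗n}) + 1 + δ m log₂ d +
4`, with `d` the dimension of one copy of `σ`. Dividing by `n` along the good `n` and letting `δ`
shrink yields `r E_∞(σ) ≤ E_∞(ρ)` (`mul_le_of_frequently_le`). The limits exist by Fekete's lemma,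
since `E_r` is subadditive under tensor products (`subadditive_entReal`).

The analytic core is `entReal_le_of_traceNorm_le`. Write `ρ - σ = P - N` with `P, N ≥ 0` and `κ = Tr
N = Tr P`. Then `(ρ + N)/(1 + κ) = (σ + P)/(1 + κ)` is a mixture containing both states. Its `E_r`
is at most the weighted `E_r(ρ)` plus the weighted log-dimension plus one bit (`entReal_mix_le`),
and at least the weighted `E_r(σ)` minus one bit (`entReal_mix_ge`). The first bound needs Klein's
inequality; the second also needs an operator-monotonicity estimate for the logarithm
(`crossLog_ge_of_smul_le`).

For the singlet it remains to see `E_∞ ≥ 1`: a separable state has overlap at most `2⁻ⁿ` with `n`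
singlets, and concavity of the logarithm turns this into `E_r ≥ n`. A multipartite bound is the
bipartite argument across one cut, once tensor powers are shown to commute with cutting up to
relabelling. -/

namespace AEN

/-! ### Functional calculus in an explicit eigenbasis, and supports. -/

section Spectral

variable {I J : Type*} [Fintype I] [DecidableEq I] [Fintype J] [DecidableEq J]

/-- The operator with eigenvalues `μ` in the orthonormal basis given by the columns of `U`. -/
def conjDiag (U : Matrix I I ℂ) (μ : I → ℝ) : Matrix I I ℂ :=
  U * Matrix.diagonal (fun i => (μ i : ℂ)) * Uᴴ

theorem unitary_mul_conjTranspose {U : Matrix I I ℂ} (hU : U ∈ Matrix.unitaryGroup I ℂ) :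
    U * Uᴴ = 1 := Matrix.mem_unitaryGroup_iff.1 hU

theorem unitary_conjTranspose_mul {U : Matrix I I ℂ} (hU : U ∈ Matrix.unitaryGroup I ℂ) :
    Uᴴ * U = 1 := Matrix.mem_unitaryGroup_iff'.1 hU

theorem exists_conjDiag {σ : Matrix I I ℂ} (hσ : σ.IsHermitian) :
    ∃ U ∈ Matrix.unitaryGroup I ℂ, ∃ μ : I → ℝ, σ = conjDiag U μ := by
  refine ⟨hσ.eigenvectorUnitary, hσ.eigenvectorUnitary.2, hσ.eigenvalues, ?_⟩
  conv_lhs => rw [hσ.spectral_theorem]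
  rw [Unitary.conjStarAlgAut_apply]
  rfl

theorem isHermitian_conjDiag (U : Matrix I I ℂ) (μ : I → ℝ) : (conjDiag U μ).IsHermitian := by
  apply Matrix.isHermitian_mul_mul_conjTranspose
  rw [Matrix.IsHermitian, Matrix.diagonal_conjTranspose]
  congr 1
  ext i
  simp

theorem posSemidef_conjDiag (U : Matrix I I ℂ) {μ : I → ℝ} (hμ : ∀ i, 0 ≤ μ i) :
    (conjDiag U μ).PosSemidef := by
  apply Matrix.PosSemidef.mul_mul_conjTranspose_same
  apply Matrix.PosSemidef.diagonal
  intro i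
  simpa using hμ i

theorem conjDiag_add (U : Matrix I I ℂ) (μ ν : I → ℝ) :
    conjDiag U μ + conjDiag U ν = conjDiag U (μ + ν) := by
  simp only [conjDiag, ← Matrix.add_mul, ← Matrix.mul_add, Matrix.diagonal_add]
  simp

theorem conjDiag_smul (U : Matrix I I ℂ) (c : ℝ) (μ : I → ℝ) :
    c • conjDiag U μ = conjDiag U (c • μ) := by
  have : Matrix.diagonal (fun i => (((c • μ) i : ℝ) : ℂ)) =
      c • Matrix.diagonal (fun i => (μ i : ℂ)) := by
    ext i j
    by_cases h : i = j
    · subst h; simp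
    · simp [h]
  rw [conjDiag, conjDiag, this, Matrix.mul_smul, Matrix.smul_mul]

theorem conjDiag_const {U : Matrix I I ℂ} (hU : U ∈ Matrix.unitaryGroup I ℂ) (c : ℝ) :
    conjDiag U (fun _ => c) = c • (1 : Matrix I I ℂ) := by
  have : Matrix.diagonal (fun _ : I => (c : ℂ)) = c • (1 : Matrix I I ℂ) := by
    ext i j
    by_cases h : i = j
    · subst h; simp
    · simp [h]
  rw [conjDiag, this, Matrix.mul_smul, Matrix.smul_mul, mul_one, unitary_mul_conjTranspose hU]

theorem conjDiag_mul {U : Matrix I I ℂ} (hU : U ∈ Matrix.unitaryGroup I ℂ) (μ ν : I → ℝ) :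
    conjDiag U μ * conjDiag U ν = conjDiag U (μ * ν) := by
  have : conjDiag U μ * conjDiag U ν = U * Matrix.diagonal (fun i => (μ i : ℂ)) * (Uᴴ * U) *
      Matrix.diagonal (fun i => (ν i : ℂ)) * Uᴴ := by
    simp only [conjDiag, mul_assoc]
  rw [this, unitary_conjTranspose_mul hU, mul_one, mul_assoc U, Matrix.diagonal_mul_diagonal,
    conjDiag]
  simp

theorem trace_conjDiag {U : Matrix I I ℂ} (hU : U ∈ Matrix.unitaryGroup I ℂ) (μ : I → ℝ) :
    (conjDiag U μ).trace = ∑ i, (μ i : ℂ) := by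
  rw [conjDiag, Matrix.trace_mul_comm, ← mul_assoc, unitary_conjTranspose_mul hU, one_mul,
    Matrix.trace_diagonal]

open Polynomial in
theorem aeval_conjDiag {U : Matrix I I ℂ} (hU : U ∈ Matrix.unitaryGroup I ℂ) (μ : I → ℝ)
    (q : ℝ[X]) : aeval (conjDiag U μ) q = conjDiag U (fun i => q.eval (μ i)) := by
  induction q using Polynomial.induction_on' with
  | add p q hp hq =>
    rw [map_add, hp, hq, conjDiag_add]
    congr 1
    ext i
    simp
  | monomial n a =>
    have hpow : conjDiag U μ ^ n = conjDiag U (μ ^ n) := by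
      induction n with
      | zero =>
        rw [pow_zero, pow_zero]
        exact ((conjDiag_const hU 1).trans (one_smul _ _)).symm
      | succ n ih => rw [pow_succ, ih, conjDiag_mul hU, pow_succ]
    rw [aeval_monomial, ← Algebra.smul_def, hpow, conjDiag_smul]
    congr 1
    ext i
    simp

/-- Replace `f` by a Lagrange interpolant through the spectrum and all the `μ i`: on polynomials the
functional calculus is plain algebra. All traces of logarithms thereby become finite sums over
eigenvalues. -/
theorem cfc_conjDiag {U : Matrix I I ℂ} (hU : U ∈ Matrix.unitaryGroup I ℂ) (μ : I → ℝ)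
    (f : ℝ → ℝ) : cfc f (conjDiag U μ) = conjDiag U (fun i => f (μ i)) := by
  have hA := isHermitian_conjDiag U μ
  have hfin : (spectrum ℝ (conjDiag U μ)).Finite := Matrix.finite_real_spectrum
  let s : Finset ℝ := hfin.toFinset ∪ Finset.univ.image μ
  let q := Lagrange.interpolate s id f
  have hq : ∀ x ∈ s, q.eval x = f x := fun x hx =>
    Lagrange.eval_interpolate_at_node f (Set.injOn_id _) hx
  have hcongr : cfc f (conjDiag U μ) = cfc q.eval (conjDiag U μ) :=
    cfc_congr fun x hx => (hq x (by simp [s, hx])).symm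
  rw [hcongr]
  refine (cfc_polynomial q (conjDiag U μ) hA).trans ((aeval_conjDiag hU μ q).trans ?_)
  congr 1
  ext i
  exact hq _ (by simp [s])

/-- The diagonal entries of `ρ` in the basis `U`. -/
def weight (U ρ : Matrix I I ℂ) (j : I) : ℝ := ((Uᴴ * ρ * U) j j).re

theorem weight_nonneg (U : Matrix I I ℂ) {ρ : Matrix I I ℂ} (hρ : ρ.PosSemidef) (j : I) :
    0 ≤ weight U ρ j :=
  (Complex.le_def.1 ((hρ.conjTranspose_mul_mul_same U).diag_nonneg (i := j))).1

theorem sum_weight {U : Matrix I I ℂ} (hU : U ∈ Matrix.unitaryGroup I ℂ) (ρ : Matrix I I ℂ) :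
    ∑ j, weight U ρ j = ρ.trace.re := by
  have : ρ.trace = (Uᴴ * ρ * U).trace := by
    rw [Matrix.trace_mul_comm, ← mul_assoc, unitary_mul_conjTranspose hU, one_mul]
  rw [this, Matrix.trace, Complex.re_sum]
  rfl

theorem trace_mul_conjDiag (U ρ : Matrix I I ℂ) (g : I → ℝ) :
    (ρ * conjDiag U g).trace.re = ∑ j, g j * weight U ρ j := by
  have : (ρ * conjDiag U g).trace =
      (Uᴴ * ρ * U * Matrix.diagonal (fun i => (g i : ℂ))).trace := by
    rw [conjDiag, ← mul_assoc, ← mul_assoc, Matrix.trace_mul_comm, ← mul_assoc, ← mul_assoc]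
  rw [this, Matrix.trace, Complex.re_sum]
  refine Finset.sum_congr rfl fun j _ => ?_
  simp [Matrix.mul_diagonal, weight, mul_comm]

theorem weight_conjDiag_self {U : Matrix I I ℂ} (hU : U ∈ Matrix.unitaryGroup I ℂ) (μ : I → ℝ)
    (j : I) : weight U (conjDiag U μ) j = μ j := by
  have : Uᴴ * conjDiag U μ * U = Matrix.diagonal (fun i => (μ i : ℂ)) := by
    have : Uᴴ * conjDiag U μ * U =
      (Uᴴ * U) * Matrix.diagonal (fun i => (μ i : ℂ)) * (Uᴴ * U) := by
      simp only [conjDiag, mul_assoc]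
    rw [this, unitary_conjTranspose_mul hU, one_mul, mul_one]
  simp [weight, this]

theorem nonneg_of_posSemidef_conjDiag {U : Matrix I I ℂ} (hU : U ∈ Matrix.unitaryGroup I ℂ)
    {μ : I → ℝ} (h : (conjDiag U μ).PosSemidef) (j : I) : 0 ≤ μ j :=
  weight_conjDiag_self hU μ j ▸ weight_nonneg U h j

theorem exists_conjDiag_of_posSemidef {σ : Matrix I I ℂ} (hσ : σ.PosSemidef) :
    ∃ U ∈ Matrix.unitaryGroup I ℂ, ∃ μ : I → ℝ, (∀ i, 0 ≤ μ i) ∧ σ = conjDiag U μ := by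
  obtain ⟨U, hU, μ, rfl⟩ := exists_conjDiag hσ.1
  exact ⟨U, hU, μ, nonneg_of_posSemidef_conjDiag hU hσ, rfl⟩

theorem weight_conjDiag (U V : Matrix I I ℂ) (lam : I → ℝ) (j : I) :
    weight U (conjDiag V lam) j = ∑ i, lam i * Complex.normSq ((Uᴴ * V) j i) := by
  have : Uᴴ * conjDiag V lam * U =
      (Uᴴ * V) * Matrix.diagonal (fun i => (lam i : ℂ)) * (Uᴴ * V)ᴴ := by
    simp only [conjDiag, Matrix.conjTranspose_mul, Matrix.conjTranspose_conjTranspose, mul_assoc]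
  rw [weight, this, Matrix.mul_apply, Complex.re_sum]
  refine Finset.sum_congr rfl fun i _ => ?_
  rw [Matrix.mul_diagonal, Matrix.conjTranspose_apply, mul_right_comm, Complex.star_def,
    Complex.mul_conj, ← Complex.ofReal_mul, Complex.ofReal_re, mul_comm]

theorem sum_normSq_row {W : Matrix I I ℂ} (hW : W * Wᴴ = 1) (j : I) :
    ∑ i, Complex.normSq (W j i) = 1 := by
  have := congrArg Complex.re (congrFun (congrFun hW j) j)
  rw [Matrix.mul_apply, Complex.re_sum] at this
  simpa [Matrix.conjTranspose_apply, Complex.mul_conj, Complex.normSq_apply] using this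

theorem sum_normSq_col {W : Matrix I I ℂ} (hW : Wᴴ * W = 1) (i : I) :
    ∑ j, Complex.normSq (W j i) = 1 := by
  have := sum_normSq_row (W := Wᴴ) (by simpa using hW) i
  simpa [Matrix.conjTranspose_apply] using this

theorem overlap_mul_conjTranspose {U V : Matrix I I ℂ} (hU : U ∈ Matrix.unitaryGroup I ℂ)
    (hV : V ∈ Matrix.unitaryGroup I ℂ) : (Uᴴ * V) * (Uᴴ * V)ᴴ = 1 := by
  rw [Matrix.conjTranspose_mul, Matrix.conjTranspose_conjTranspose, mul_assoc, ← mul_assoc V,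
    unitary_mul_conjTranspose hV, one_mul, unitary_conjTranspose_mul hU]

theorem overlap_conjTranspose_mul {U V : Matrix I I ℂ} (hU : U ∈ Matrix.unitaryGroup I ℂ)
    (hV : V ∈ Matrix.unitaryGroup I ℂ) : (Uᴴ * V)ᴴ * (Uᴴ * V) = 1 := by
  rw [Matrix.conjTranspose_mul, Matrix.conjTranspose_conjTranspose, mul_assoc, ← mul_assoc U,
    unitary_mul_conjTranspose hU, one_mul, unitary_conjTranspose_mul hV]

/-- The support of `ρ` is contained in the support of `σ`. -/
def SuppLE (ρ σ : Matrix I I ℂ) : Prop := ∀ v : I → ℂ, σ *ᵥ v = 0 → ρ *ᵥ v = 0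

/-- This makes the convention `Real.logb 2 0 = 0` harmless: under support inclusion, every term with
a zero eigenvalue carries weight zero. -/
theorem weight_eq_zero {U : Matrix I I ℂ} (hU : U ∈ Matrix.unitaryGroup I ℂ) {μ : I → ℝ}
    {ρ : Matrix I I ℂ} (h : SuppLE ρ (conjDiag U μ)) {j : I} (hj : μ j = 0) :
    weight U ρ j = 0 := by
  have h1 : conjDiag U μ *ᵥ (U *ᵥ Pi.single j 1) = 0 := by
    have : conjDiag U μ * U = U * Matrix.diagonal (fun i => (μ i : ℂ)) := by
      rw [conjDiag, mul_assoc, unitary_conjTranspose_mul hU, mul_one]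
    rw [Matrix.mulVec_mulVec, this, ← Matrix.mulVec_mulVec, Matrix.diagonal_mulVec_single, hj]
    simp
  have h2 := h _ h1
  have h3 : (Uᴴ * ρ * U) *ᵥ Pi.single j 1 = 0 := by
    rw [← Matrix.mulVec_mulVec, ← Matrix.mulVec_mulVec, h2, Matrix.mulVec_zero]
  have h4 := congrFun h3 j
  rw [Matrix.mulVec_single_one] at h4
  simp only [Matrix.col_apply, Pi.zero_apply] at h4
  rw [weight, h4, Complex.zero_re]

theorem suppLE_of_posSemidef_sub {ρ σ : Matrix I I ℂ} {c : ℝ} (hc : 0 < c) (hρ : ρ.PosSemidef)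
    (h : (σ - c • ρ).PosSemidef) : SuppLE ρ σ := by
  intro v hv
  have h1 := h.dotProduct_mulVec_nonneg v
  rw [Matrix.sub_mulVec, hv, zero_sub, Matrix.smul_mulVec, dotProduct_neg, dotProduct_smul] at h1
  rw [← hρ.dotProduct_mulVec_zero_iff]
  have h2 := hρ.dotProduct_mulVec_nonneg v
  refine le_antisymm ?_ h2
  have h3 : c • (star v ⬝ᵥ ρ *ᵥ v) ≤ 0 := by simpa using h1
  rw [Complex.le_def] at h3 h2 ⊢
  simp only [Complex.real_smul, Complex.mul_re, Complex.ofReal_re, Complex.ofReal_im, zero_mul,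
    sub_zero, Complex.zero_re, Complex.mul_im, add_zero, Complex.zero_im] at h3 h2 ⊢
  exact ⟨by nlinarith [h3.1], h2.2.symm⟩

theorem SuppLE.trans {ρ σ τ : Matrix I I ℂ} (h : SuppLE ρ σ) (h' : SuppLE σ τ) : SuppLE ρ τ :=
  fun v hv => h v (h' v hv)

end Spectral

/-! ### Inequalities for `Tr(ρ log₂ σ)`. -/

section Entropy

variable {I J : Type*} [Fintype I] [DecidableEq I] [Fintype J] [DecidableEq J]

/-- `Tr(ρ log₂ σ)`. -/
noncomputable def crossLog (ρ σ : Matrix I I ℂ) : ℝ := (ρ * cfc (Real.logb 2) σ).trace.re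

theorem relEntropy_of_suppLE {ρ σ : Matrix I I ℂ} (h : SuppLE ρ σ) :
    relEntropy ρ σ = ((crossLog ρ ρ - crossLog ρ σ : ℝ) : EReal) := by
  refine (if_pos h).trans ?_
  rw [Complex.sub_re]
  rfl

theorem relEntropy_of_not_suppLE {ρ σ : Matrix I I ℂ} (h : ¬ SuppLE ρ σ) :
    relEntropy ρ σ = ⊤ := if_neg h

theorem crossLog_conjDiag (ρ : Matrix I I ℂ) {U : Matrix I I ℂ}
    (hU : U ∈ Matrix.unitaryGroup I ℂ) (μ : I → ℝ) :
    crossLog ρ (conjDiag U μ) = ∑ j, Real.logb 2 (μ j) * weight U ρ j := by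
  rw [crossLog, cfc_conjDiag hU, trace_mul_conjDiag]

theorem crossLog_add (ρ ρ' σ : Matrix I I ℂ) :
    crossLog (ρ + ρ') σ = crossLog ρ σ + crossLog ρ' σ := by
  simp [crossLog, add_mul]

theorem crossLog_smul (c : ℝ) (ρ σ : Matrix I I ℂ) :
    crossLog (c • ρ) σ = c * crossLog ρ σ := by
  simp [crossLog]

theorem mul_logb_le {x y : ℝ} (hx : 0 ≤ x) (hy : 0 ≤ y) (h : y = 0 → x = 0) :
    Real.logb 2 y * x ≤ Real.logb 2 x * x + (y - x) / Real.log 2 := by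
  have h2 : 0 < Real.log 2 := Real.log_pos (by norm_num)
  rcases hx.eq_or_lt with rfl | hx
  · simp only [mul_zero, sub_zero, zero_add]
    positivity
  have hy : 0 < y := hy.lt_of_ne fun h0 => hx.ne' (h h0.symm)
  have h3 : Real.log (y / x) ≤ y / x - 1 := Real.log_le_sub_one_of_pos (by positivity)
  rw [Real.log_div hy.ne' hx.ne'] at h3
  have h4 : (Real.log y - Real.log x) * x ≤ y - x := by
    calc _ ≤ (y / x - 1) * x := by gcongr
      _ = y - x := by field_simp
  have h5 := div_le_div_of_nonneg_right h4 h2.le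
  have h6 : Real.logb 2 y * x - Real.logb 2 x * x = (Real.log y - Real.log x) * x / Real.log 2 := by
    simp only [Real.logb]
    ring
  linarith

/-- Klein's inequality. -/
theorem crossLog_le_self {ρ σ : Matrix I I ℂ} (hρ : ρ.PosSemidef) (hσ : σ.PosSemidef)
    (hT : σ.trace.re ≤ ρ.trace.re) (h : SuppLE ρ σ) : crossLog ρ σ ≤ crossLog ρ ρ := by
  obtain ⟨U, hU, μ, hμ, rfl⟩ := exists_conjDiag_of_posSemidef hσ
  obtain ⟨V, hV, lam, hl, rfl⟩ := exists_conjDiag_of_posSemidef hρ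
  have h2 : 0 < Real.log 2 := Real.log_pos (by norm_num)
  have hzero : ∀ j i, μ j = 0 → lam i * Complex.normSq ((Uᴴ * V) j i) = 0 := by
    intro j i hj
    have h3 := weight_eq_zero hU h hj
    rw [weight_conjDiag, Finset.sum_eq_zero_iff_of_nonneg
      fun i _ => mul_nonneg (hl i) (Complex.normSq_nonneg _)] at h3
    exact h3 i (Finset.mem_univ _)
  have hrow := sum_normSq_row (overlap_mul_conjTranspose hU hV)
  have hcol := sum_normSq_col (overlap_conjTranspose_mul hU hV)
  rw [trace_conjDiag hU, trace_conjDiag hV, Complex.re_sum, Complex.re_sum] at hT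
  simp only [Complex.ofReal_re] at hT
  rw [crossLog_conjDiag _ hU, crossLog_conjDiag _ hV]
  simp only [weight_conjDiag_self hV, weight_conjDiag]
  set a : I → I → ℝ := fun j i => Complex.normSq ((Uᴴ * V) j i)
  -- The squared overlaps `a j i` of the two eigenbases form a doubly stochastic matrix, so the
  -- scalar inequality weighted by `a j i` sums to the operator one, the correction collapsing to
  -- the difference of the traces.
  have key : ∀ j i, Real.logb 2 (μ j) * (lam i * a j i) ≤
      Real.logb 2 (lam i) * lam i * a j i + (μ j * a j i - lam i * a j i) / Real.log 2 := by
    intro j i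
    rcases (Complex.normSq_nonneg ((Uᴴ * V) j i)).eq_or_lt with h0 | h0
    · have : a j i = 0 := h0.symm
      simp [this]
    have h0 : 0 < a j i := h0
    have h3 := mul_logb_le (hl i) (hμ j) fun hj => by
      have := hzero j i hj
      exact (mul_eq_zero.1 this).resolve_right h0.ne'
    have h4 := mul_le_mul_of_nonneg_right h3 h0.le
    calc _ = Real.logb 2 (μ j) * lam i * a j i := by ring
      _ ≤ _ := h4
      _ = _ := by ring
  calc ∑ j, Real.logb 2 (μ j) * ∑ i, lam i * a j i
      = ∑ j, ∑ i, Real.logb 2 (μ j) * (lam i * a j i) := by simp only [Finset.mul_sum]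
    _ ≤ ∑ j, ∑ i, (Real.logb 2 (lam i) * lam i * a j i +
          (μ j * a j i - lam i * a j i) / Real.log 2) :=
        Finset.sum_le_sum fun j _ => Finset.sum_le_sum fun i _ => key j i
    _ = ∑ i, Real.logb 2 (lam i) * lam i + (∑ j, μ j - ∑ i, lam i) / Real.log 2 := by
        simp only [Finset.sum_add_distrib, ← Finset.sum_div, Finset.sum_sub_distrib]
        rw [Finset.sum_comm, Finset.sum_comm (f := fun j i => lam i * a j i)]
        simp only [← Finset.mul_sum, a, hrow, hcol, mul_one]
    _ ≤ ∑ i, Real.logb 2 (lam i) * lam i := by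
        have : (∑ j, μ j - ∑ i, lam i) / Real.log 2 ≤ 0 :=
          div_nonpos_of_nonpos_of_nonneg (by linarith) h2.le
        linarith

theorem conjDiag_mix {U : Matrix I I ℂ} (hU : U ∈ Matrix.unitaryGroup I ℂ) (μ : I → ℝ) (s t : ℝ) :
    s • conjDiag U μ + t • (1 : Matrix I I ℂ) = conjDiag U (fun i => s * μ i + t) := by
  rw [← conjDiag_const hU, conjDiag_smul, conjDiag_add]
  rfl

/-- Each eigenvalue `μ` of `τ` becomes `s μ + t ≥ s μ`, so the logarithm drops by at most `log₂
(1/s)` on the support of `τ`. -/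
theorem crossLog_mix_ge {ρ τ : Matrix I I ℂ} (hρ : ρ.PosSemidef) (hτ : τ.PosSemidef)
    (h : SuppLE ρ τ) {s t : ℝ} (hs : 0 < s) (ht : 0 ≤ t) :
    crossLog ρ τ + ρ.trace.re * Real.logb 2 s ≤ crossLog ρ (s • τ + t • (1 : Matrix I I ℂ)) := by
  obtain ⟨U, hU, μ, hμ, rfl⟩ := exists_conjDiag_of_posSemidef hτ
  rw [conjDiag_mix hU, crossLog_conjDiag _ hU, crossLog_conjDiag _ hU, ← sum_weight hU,
    Finset.sum_mul, ← Finset.sum_add_distrib]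
  refine Finset.sum_le_sum fun j _ => ?_
  rcases (hμ j).eq_or_lt with h0 | h0
  · simp [weight_eq_zero hU h h0.symm]
  rw [mul_comm (weight U ρ j), ← add_mul, ← Real.logb_mul h0.ne' hs.ne']
  refine mul_le_mul_of_nonneg_right ?_ (weight_nonneg U hρ j)
  refine Real.logb_le_logb_of_le (by norm_num) (by positivity) ?_
  linarith [mul_comm s (μ j)]

theorem trace_mul_logb_le_crossLog_mix {ρ τ : Matrix I I ℂ} (hρ : ρ.PosSemidef) (hτ : τ.PosSemidef)
    {s t : ℝ} (hs : 0 ≤ s) (ht : 0 < t) :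
    ρ.trace.re * Real.logb 2 t ≤ crossLog ρ (s • τ + t • (1 : Matrix I I ℂ)) := by
  obtain ⟨U, hU, μ, hμ, rfl⟩ := exists_conjDiag_of_posSemidef hτ
  rw [conjDiag_mix hU, crossLog_conjDiag _ hU, ← sum_weight hU, Finset.sum_mul]
  refine Finset.sum_le_sum fun j _ => ?_
  rw [mul_comm (weight U ρ j)]
  refine mul_le_mul_of_nonneg_right ?_ (weight_nonneg U hρ j)
  refine Real.logb_le_logb_of_le (by norm_num) ht ?_
  nlinarith [mul_nonneg hs (hμ j)]

theorem suppLE_mix {ρ τ : Matrix I I ℂ} (hτ : τ.PosSemidef) {s t : ℝ} (hs : 0 ≤ s) (ht : 0 < t) :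
    SuppLE ρ (s • τ + t • (1 : Matrix I I ℂ)) := by
  have h1 : SuppLE (1 : Matrix I I ℂ) (s • τ + t • (1 : Matrix I I ℂ)) := by
    apply suppLE_of_posSemidef_sub ht Matrix.PosSemidef.one
    rw [add_sub_cancel_right]
    exact hτ.smul hs
  intro v hv
  have := h1 v hv
  rw [Matrix.one_mulVec] at this
  rw [this, Matrix.mulVec_zero]

/-- Jensen's inequality `Tr(ρ log τ) ≤ log Tr(ρ τ)`, obtained by bounding the logarithm by its
tangent at `b`. -/
theorem crossLog_le_of_trace_mul_le {ρ τ : Matrix I I ℂ} (hρ : ρ.PosSemidef)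
    (hτ : τ.PosSemidef) (h : SuppLE ρ τ) (hT : ρ.trace.re = 1) {b : ℝ} (hb : 0 < b)
    (hle : (ρ * τ).trace.re ≤ b) : crossLog ρ τ ≤ Real.logb 2 b := by
  obtain ⟨U, hU, μ, hμ, rfl⟩ := exists_conjDiag_of_posSemidef hτ
  have h2 : 0 < Real.log 2 := Real.log_pos (by norm_num)
  rw [trace_mul_conjDiag] at hle
  rw [← sum_weight hU] at hT
  rw [crossLog_conjDiag _ hU]
  have key : ∀ j, Real.logb 2 (μ j) * weight U ρ j ≤
      Real.logb 2 b * weight U ρ j + (μ j * weight U ρ j / b - weight U ρ j) / Real.log 2 := by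
    intro j
    rcases (hμ j).eq_or_lt with h0 | h0
    · simp [weight_eq_zero hU h h0.symm]
    have h3 : Real.log (μ j / b) ≤ μ j / b - 1 := Real.log_le_sub_one_of_pos (by positivity)
    rw [Real.log_div h0.ne' hb.ne'] at h3
    have h4 := div_le_div_of_nonneg_right
      (mul_le_mul_of_nonneg_right h3 (weight_nonneg U hρ j)) h2.le
    have h5 : Real.logb 2 (μ j) * weight U ρ j - Real.logb 2 b * weight U ρ j =
      (Real.log (μ j) - Real.log b) * weight U ρ j / Real.log 2 := by
      simp only [Real.logb]
      ring
    have h6 : (μ j / b - 1) * weight U ρ j = μ j * weight U ρ j / b - weight U ρ j := by ring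
    rw [h6] at h4
    linarith
  refine (Finset.sum_le_sum fun j _ => key j).trans ?_
  rw [Finset.sum_add_distrib, ← Finset.mul_sum, hT, ← Finset.sum_div, Finset.sum_sub_distrib, hT,
    ← Finset.sum_div, mul_one]
  have : ((∑ j, μ j * weight U ρ j) / b - 1) / Real.log 2 ≤ 0 := by
    refine div_nonpos_of_nonpos_of_nonneg ?_ h2.le
    rw [sub_nonpos, div_le_one hb]
    exact hle
  linarith

theorem crossLog_self_of_mul_self {ρ : Matrix I I ℂ} (hρ : ρ.PosSemidef) (h : ρ * ρ = ρ) :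
    crossLog ρ ρ = 0 := by
  obtain ⟨U, hU, μ, hμ, rfl⟩ := exists_conjDiag_of_posSemidef hρ
  rw [crossLog_conjDiag _ hU]
  refine Finset.sum_eq_zero fun j _ => ?_
  have h1 := congrArg (fun X => weight U X j) h
  simp only [conjDiag_mul hU, weight_conjDiag_self hU, Pi.mul_apply] at h1
  rcases IsIdempotentElem.iff_eq_zero_or_one.1 h1 with h0 | h0 <;> simp [h0]

theorem crossLog_self_nonpos {ρ : Matrix I I ℂ} (hρ : IsState ρ) : crossLog ρ ρ ≤ 0 := by
  obtain ⟨hρ, hT⟩ := hρ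
  obtain ⟨U, hU, μ, hμ, rfl⟩ := exists_conjDiag_of_posSemidef hρ
  have hT := congrArg Complex.re hT
  rw [trace_conjDiag hU, Complex.re_sum] at hT
  simp only [Complex.ofReal_re, Complex.one_re] at hT
  rw [crossLog_conjDiag _ hU]
  refine Finset.sum_nonpos fun j _ => ?_
  rw [weight_conjDiag_self hU]
  refine mul_nonpos_of_nonpos_of_nonneg ?_ (hμ j)
  refine Real.logb_nonpos (by norm_num) (hμ j) ?_
  rw [← hT]
  exact Finset.single_le_sum (fun i _ => hμ i) (Finset.mem_univ j)

/-- With `ω = conjDiag U μ` and `v` the `i`-th column of `V`, this is `log λ ≤ ⟨v, log ω v⟩`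
whenever `ω` dominates an operator with eigenpair `(λ, v)`. It follows from `λ ⟨v, ω⁻¹ v⟩ ≤ 1` by
averaging `log (λ/μ) ≤ λ/μ - 1`, without the general theory of operator monotone functions. -/
theorem logb_le_sum_logb_mul_normSq {U V : Matrix I I ℂ} (hU : U ∈ Matrix.unitaryGroup I ℂ)
    (hV : V ∈ Matrix.unitaryGroup I ℂ) {μ lam : I → ℝ} (hμ : ∀ i, 0 ≤ μ i) (hl : ∀ i, 0 ≤ lam i)
    (h : (conjDiag U μ - conjDiag V lam).PosSemidef) {i : I} (hi : 0 < lam i) :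
    Real.logb 2 (lam i) ≤ ∑ j, Real.logb 2 (μ j) * Complex.normSq ((Uᴴ * V) j i) := by
  have h2 : 0 < Real.log 2 := Real.log_pos (by norm_num)
  have hrow := sum_normSq_row (overlap_mul_conjTranspose hU hV)
  have hcol := sum_normSq_col (overlap_conjTranspose_mul hU hV)
  set W := Uᴴ * V with hW
  have hpsd : (Matrix.diagonal (fun j => (μ j : ℂ)) - conjDiag W lam).PosSemidef := by
    have h3 := h.conjTranspose_mul_mul_same U
    have h4 : Uᴴ * (conjDiag U μ - conjDiag V lam) * U =
        (Uᴴ * U) * Matrix.diagonal (fun j => (μ j : ℂ)) * (Uᴴ * U) - conjDiag W lam := by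
      simp only [conjDiag, hW, Matrix.conjTranspose_mul, Matrix.conjTranspose_conjTranspose,
        Matrix.mul_sub, Matrix.sub_mul, mul_assoc]
    rwa [h4, unitary_conjTranspose_mul hU, one_mul, mul_one] at h3
  -- Eigenvectors of `ω` with eigenvalue zero are orthogonal to `v`, so the convention `x / 0 = 0`
  -- loses nothing in the sum `x = ⟨v, ω⁻¹ v⟩` below.
  have hzero : ∀ j, μ j = 0 → Complex.normSq (W j i) = 0 := by
    intro j hj
    have h3 := (Complex.le_def.1 (hpsd.diag_nonneg (i := j))).1
    have h4 : ((conjDiag W lam) j j).re = ∑ k, lam k * Complex.normSq (W j k) := by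
      have := weight_conjDiag 1 W lam j
      simpa [weight] using this
    rw [Matrix.sub_apply, Complex.sub_re, h4, Matrix.diagonal_apply_eq, hj] at h3
    simp only [Complex.ofReal_zero, Complex.zero_re, zero_sub] at h3
    have h5 : lam i * Complex.normSq (W j i) ≤ ∑ k, lam k * Complex.normSq (W j k) :=
      Finset.single_le_sum (f := fun k => lam k * Complex.normSq (W j k))
        (fun k _ => mul_nonneg (hl k) (Complex.normSq_nonneg _)) (Finset.mem_univ i)
    have h6 := Complex.normSq_nonneg (W j i)
    nlinarith
  set x : ℝ := ∑ j, Complex.normSq (W j i) / μ j with hx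
  have hx0 : 0 ≤ x := Finset.sum_nonneg fun j _ => div_nonneg (Complex.normSq_nonneg _) (hμ j)
  have hxle : lam i * x ≤ 1 := by
    -- Test positivity on `b = ω⁻¹ v`: the form of `ω` gives `x`, the dominated operator at least `λ
    -- x²`. Hence `λ x² ≤ x`.
    let b : I → ℂ := fun j => W j i / (μ j : ℂ)
    have h3 := (Complex.le_def.1 (hpsd.dotProduct_mulVec_nonneg b)).1
    have h4 : (star b ⬝ᵥ Matrix.diagonal (fun j => (μ j : ℂ)) *ᵥ b).re = x := by
      rw [dotProduct, Complex.re_sum, hx]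
      refine Finset.sum_congr rfl fun j _ => ?_
      rw [Matrix.mulVec_diagonal]
      rcases (hμ j).eq_or_lt with h0 | h0
      · simp [← h0]
      have h0' : (μ j : ℂ) ≠ 0 := by exact_mod_cast h0.ne'
      have : star b j * ((μ j : ℂ) * b j) = ((Complex.normSq (W j i) / μ j : ℝ) : ℂ) := by
        simp only [b, Pi.star_apply, Complex.star_def, map_div₀, Complex.conj_ofReal]
        push_cast
        rw [Complex.normSq_eq_conj_mul_self]
        field_simp
      rw [this, Complex.ofReal_re]
    have h5 : ∀ k, (Wᴴ *ᵥ b) k = ∑ j, star (W j k) * b j := fun k => rfl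
    have h6 : (Wᴴ *ᵥ b) i = (x : ℂ) := by
      rw [h5, hx]
      push_cast
      refine Finset.sum_congr rfl fun j _ => ?_
      rw [Complex.normSq_eq_conj_mul_self]
      simp only [b, Complex.star_def, mul_div_assoc]
    have h7 : (star b ⬝ᵥ conjDiag W lam *ᵥ b).re =
        ∑ k, lam k * Complex.normSq ((Wᴴ *ᵥ b) k) := by
      have : star b ⬝ᵥ conjDiag W lam *ᵥ b =
          star (Wᴴ *ᵥ b) ⬝ᵥ Matrix.diagonal (fun j => (lam j : ℂ)) *ᵥ (Wᴴ *ᵥ b) := by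
        rw [Matrix.star_mulVec, Matrix.conjTranspose_conjTranspose, ← Matrix.dotProduct_mulVec,
          Matrix.mulVec_mulVec, Matrix.mulVec_mulVec, conjDiag, mul_assoc]
      rw [this, dotProduct, Complex.re_sum]
      refine Finset.sum_congr rfl fun k _ => ?_
      rw [Matrix.mulVec_diagonal, Pi.star_apply, Complex.star_def, mul_left_comm,
        ← Complex.normSq_eq_conj_mul_self, ← Complex.ofReal_mul, Complex.ofReal_re]
    rw [Matrix.sub_mulVec, dotProduct_sub, Complex.sub_re, h4, h7] at h3
    have h8 : lam i * Complex.normSq ((Wᴴ *ᵥ b) i) ≤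
        ∑ k, lam k * Complex.normSq ((Wᴴ *ᵥ b) k) :=
      Finset.single_le_sum (f := fun k => lam k * Complex.normSq ((Wᴴ *ᵥ b) k))
        (fun k _ => mul_nonneg (hl k) (Complex.normSq_nonneg _)) (Finset.mem_univ i)
    rw [h6, Complex.normSq_ofReal] at h8
    simp only [Complex.zero_re] at h3
    by_contra hcon
    push Not at hcon
    have hxpos : 0 < x := by
      rcases hx0.eq_or_lt with h0 | h0
      · rw [← h0] at hcon
        linarith [mul_zero (lam i)]
      · exact h0
    nlinarith
  have key : ∀ j, Real.logb 2 (lam i) * Complex.normSq (W j i) ≤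
      Real.logb 2 (μ j) * Complex.normSq (W j i) +
        (lam i * (Complex.normSq (W j i) / μ j) - Complex.normSq (W j i)) / Real.log 2 := by
    intro j
    rcases (hμ j).eq_or_lt with h0 | h0
    · simp [hzero j h0.symm]
    have h3 : Real.log (lam i / μ j) ≤ lam i / μ j - 1 :=
      Real.log_le_sub_one_of_pos (by positivity)
    rw [Real.log_div hi.ne' h0.ne'] at h3
    have h4 := div_le_div_of_nonneg_right
      (mul_le_mul_of_nonneg_right h3 (Complex.normSq_nonneg (W j i))) h2.le
    have h5 : Real.logb 2 (lam i) * Complex.normSq (W j i) -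
        Real.logb 2 (μ j) * Complex.normSq (W j i) =
        (Real.log (lam i) - Real.log (μ j)) * Complex.normSq (W j i) / Real.log 2 := by
      simp only [Real.logb]
      ring
    have h6 : (lam i / μ j - 1) * Complex.normSq (W j i) =
        lam i * (Complex.normSq (W j i) / μ j) - Complex.normSq (W j i) := by ring
    rw [h6] at h4
    linarith
  have h9 := Finset.sum_le_sum fun j (_ : j ∈ Finset.univ) => key j
  rw [← Finset.mul_sum, Finset.sum_add_distrib, ← Finset.sum_div, Finset.sum_sub_distrib,
    ← Finset.mul_sum, hcol, mul_one, ← hx] at h9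
  have h10 : (lam i * x - 1) / Real.log 2 ≤ 0 :=
    div_nonpos_of_nonpos_of_nonneg (by linarith) h2.le
  linarith

/-- If `c ρ ≤ ω` then `Tr(ρ log ω) ≥ Tr(ρ log ρ) + Tr(ρ) log c`. -/
theorem crossLog_ge_of_smul_le {ρ ω : Matrix I I ℂ} (hρ : ρ.PosSemidef) (hω : ω.PosSemidef)
    {c : ℝ} (hc : 0 < c) (h : (ω - c • ρ).PosSemidef) :
    crossLog ρ ρ + ρ.trace.re * Real.logb 2 c ≤ crossLog ρ ω := by
  obtain ⟨U, hU, μ, hμ, rfl⟩ := exists_conjDiag_of_posSemidef hω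
  obtain ⟨V, hV, lam, hl, rfl⟩ := exists_conjDiag_of_posSemidef hρ
  rw [conjDiag_smul] at h
  rw [crossLog_conjDiag _ hU, crossLog_conjDiag _ hV, ← sum_weight hV]
  simp only [weight_conjDiag_self hV]
  simp only [weight_conjDiag]
  have hR : ∑ j, Real.logb 2 (μ j) * ∑ i, lam i * Complex.normSq ((Uᴴ * V) j i) =
      ∑ i, lam i * ∑ j, Real.logb 2 (μ j) * Complex.normSq ((Uᴴ * V) j i) := by
    simp only [Finset.mul_sum]
    rw [Finset.sum_comm]
    exact Finset.sum_congr rfl fun i _ => Finset.sum_congr rfl fun j _ => by ring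
  rw [hR, Finset.sum_mul, ← Finset.sum_add_distrib]
  refine Finset.sum_le_sum fun i _ => ?_
  rcases (hl i).eq_or_lt with h0 | h0
  · simp [← h0]
  have h3 := logb_le_sum_logb_mul_normSq hU hV hμ (lam := c • lam)
    (fun i => mul_nonneg hc.le (hl i)) h (i := i) (mul_pos hc h0)
  rw [Pi.smul_apply, smul_eq_mul, Real.logb_mul hc.ne' h0.ne'] at h3
  have h4 := mul_le_mul_of_nonneg_left h3 h0.le
  linarith

end Entropy

/-! ### Additivity under tensor products. -/

section Tensor

variable {I J : Type*} [Fintype I] [DecidableEq I] [Fintype J] [DecidableEq J]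

theorem conjDiag_kronecker (U : Matrix I I ℂ) (V : Matrix J J ℂ) (μ : I → ℝ) (ν : J → ℝ) :
    conjDiag U μ ⊗ₖ conjDiag V ν = conjDiag (U ⊗ₖ V) (fun x => μ x.1 * ν x.2) := by
  rw [conjDiag, conjDiag, conjDiag, Matrix.mul_kronecker_mul, Matrix.mul_kronecker_mul,
    Matrix.diagonal_kronecker_diagonal, Matrix.conjTranspose_kronecker]
  simp

theorem weight_kronecker {ρ : Matrix I I ℂ} {ρ' : Matrix J J ℂ} (hρ : ρ.IsHermitian)
    (U : Matrix I I ℂ) (V : Matrix J J ℂ) (x : I × J) :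
    weight (U ⊗ₖ V) (ρ ⊗ₖ ρ') x = weight U ρ x.1 * weight V ρ' x.2 := by
  have h1 : (Uᴴ * ρ * U).IsHermitian := Matrix.isHermitian_conjTranspose_mul_mul U hρ
  have h2 : ((Uᴴ * ρ * U) x.1 x.1).im = 0 := by
    have := congrArg Complex.im (h1.apply x.1 x.1)
    rw [Complex.star_def, Complex.conj_im] at this
    linarith
  rw [weight, Matrix.conjTranspose_kronecker, ← Matrix.mul_kronecker_mul,
    ← Matrix.mul_kronecker_mul, Matrix.kroneckerMap_apply, Complex.mul_re, h2, zero_mul, sub_zero]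
  rfl

theorem SuppLE.exists_eq_mul {ρ σ : Matrix I I ℂ} (hσ : σ.PosSemidef) (h : SuppLE ρ σ) :
    ∃ X, ρ = X * σ := by
  obtain ⟨U, hU, μ, hμ, rfl⟩ := exists_conjDiag_of_posSemidef hσ
  -- `conjDiag U χ` projects onto the kernel of `σ`, which `ρ` annihilates. Since `0⁻¹ = 0`,
  -- `conjDiag U μ⁻¹` is the pseudo-inverse of `σ`, and the factor is `ρ` times it.
  let χ : I → ℝ := fun i => if μ i = 0 then 1 else 0
  have h1 : conjDiag U μ * conjDiag U χ = 0 := by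
    rw [conjDiag_mul hU]
    have : μ * χ = fun _ => 0 := by
      ext i
      by_cases hi : μ i = 0 <;> simp [χ, hi]
    rw [this, conjDiag_const hU, zero_smul]
  have h2 : ρ * conjDiag U χ = 0 := by
    apply Matrix.ext_of_mulVec_single
    intro i
    rw [← Matrix.mulVec_mulVec, h, Matrix.zero_mulVec]
    rw [Matrix.mulVec_mulVec, h1, Matrix.zero_mulVec]
  have h3 : conjDiag U χ + conjDiag U μ⁻¹ * conjDiag U μ = 1 := by
    rw [conjDiag_mul hU, conjDiag_add]
    have : χ + μ⁻¹ * μ = fun _ => 1 := by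
      ext i
      by_cases hi : μ i = 0 <;> simp [χ, hi]
    rw [this, conjDiag_const hU, one_smul]
  refine ⟨ρ * conjDiag U μ⁻¹, ?_⟩
  calc ρ = ρ * (conjDiag U χ + conjDiag U μ⁻¹ * conjDiag U μ) := by rw [h3, mul_one]
    _ = _ := by rw [mul_add, h2, zero_add, mul_assoc]

theorem SuppLE.kronecker {ρ σ : Matrix I I ℂ} {ρ' σ' : Matrix J J ℂ} (hσ : σ.PosSemidef)
    (hσ' : σ'.PosSemidef) (h : SuppLE ρ σ) (h' : SuppLE ρ' σ') :
    SuppLE (ρ ⊗ₖ ρ') (σ ⊗ₖ σ') := by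
  obtain ⟨X, rfl⟩ := h.exists_eq_mul hσ
  obtain ⟨Y, rfl⟩ := h'.exists_eq_mul hσ'
  intro v hv
  rw [Matrix.mul_kronecker_mul, ← Matrix.mulVec_mulVec, hv, Matrix.mulVec_zero]

theorem crossLog_kronecker {ρ σ : Matrix I I ℂ} {ρ' σ' : Matrix J J ℂ} (hρ : IsState ρ)
    (hρ' : IsState ρ') (hσ : σ.PosSemidef) (hσ' : σ'.PosSemidef) (h : SuppLE ρ σ)
    (h' : SuppLE ρ' σ') :
    crossLog (ρ ⊗ₖ ρ') (σ ⊗ₖ σ') = crossLog ρ σ + crossLog ρ' σ' := by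
  obtain ⟨U, hU, μ, hμ, rfl⟩ := exists_conjDiag_of_posSemidef hσ
  obtain ⟨V, hV, ν, hν, rfl⟩ := exists_conjDiag_of_posSemidef hσ'
  have hUV : U ⊗ₖ V ∈ Matrix.unitaryGroup (I × J) ℂ := Matrix.kronecker_mem_unitary hU hV
  have t1 : ∑ j, weight U ρ j = 1 := by rw [sum_weight hU, hρ.2, Complex.one_re]
  have t2 : ∑ j, weight V ρ' j = 1 := by rw [sum_weight hV, hρ'.2, Complex.one_re]
  rw [conjDiag_kronecker, crossLog_conjDiag _ hUV, crossLog_conjDiag _ hU, crossLog_conjDiag _ hV]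
  simp only [weight_kronecker hρ.1.1]
  have key : ∀ i j, Real.logb 2 (μ i * ν j) * (weight U ρ i * weight V ρ' j) =
      Real.logb 2 (μ i) * weight U ρ i * weight V ρ' j +
        weight U ρ i * (Real.logb 2 (ν j) * weight V ρ' j) := by
    intro i j
    by_cases h1 : μ i = 0
    · simp [weight_eq_zero hU h h1]
    by_cases h2 : ν j = 0
    · simp [weight_eq_zero hV h' h2]
    rw [Real.logb_mul h1 h2]
    ring
  rw [Fintype.sum_prod_type]
  simp only [key, Finset.sum_add_distrib, ← Finset.mul_sum, ← Finset.sum_mul, t1, t2, mul_one,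
    one_mul]

theorem IsState.kronecker {ρ : Matrix I I ℂ} {ρ' : Matrix J J ℂ} (hρ : IsState ρ)
    (hρ' : IsState ρ') : IsState (ρ ⊗ₖ ρ') :=
  ⟨hρ.1.kronecker hρ'.1, by rw [Matrix.trace_kronecker, hρ.2, hρ'.2, one_mul]⟩

theorem suppLE_refl (ρ : Matrix I I ℂ) : SuppLE ρ ρ := fun _ h => h

end Tensor

/-! ### Invariance under relabelling, and positive and negative parts. -/

section Reindex

variable {I J : Type*} [Fintype I] [DecidableEq I] [Fintype J] [DecidableEq J]

theorem submatrix_mem_unitaryGroup {U : Matrix I I ℂ} (hU : U ∈ Matrix.unitaryGroup I ℂ)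
    (e : J ≃ I) : U.submatrix e e ∈ Matrix.unitaryGroup J ℂ := by
  rw [Matrix.mem_unitaryGroup_iff, Matrix.star_eq_conjTranspose, Matrix.conjTranspose_submatrix,
    Matrix.submatrix_mul_equiv, unitary_mul_conjTranspose hU, Matrix.submatrix_one_equiv]

theorem conjDiag_submatrix (U : Matrix I I ℂ) (μ : I → ℝ) (e : J ≃ I) :
    (conjDiag U μ).submatrix e e = conjDiag (U.submatrix e e) (μ ∘ e) := by
  rw [conjDiag, conjDiag, Matrix.conjTranspose_submatrix, ← Matrix.submatrix_mul_equiv _ _ _ e,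
    ← Matrix.submatrix_mul_equiv _ _ _ e]
  congr 2
  exact Matrix.submatrix_diagonal_equiv _ e

theorem cfc_submatrix {σ : Matrix I I ℂ} (hσ : σ.IsHermitian) (f : ℝ → ℝ) (e : J ≃ I) :
    cfc f (σ.submatrix e e) = (cfc f σ).submatrix e e := by
  obtain ⟨U, hU, μ, rfl⟩ := exists_conjDiag hσ
  rw [conjDiag_submatrix, cfc_conjDiag (submatrix_mem_unitaryGroup hU e), cfc_conjDiag hU,
    conjDiag_submatrix]
  rfl

theorem trace_submatrix_equiv (ρ : Matrix I I ℂ) (e : J ≃ I) :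
    (ρ.submatrix e e).trace = ρ.trace :=
  e.sum_comp (fun i => ρ i i)

theorem IsState.submatrix {ρ : Matrix I I ℂ} (hρ : IsState ρ) (e : J ≃ I) :
    IsState (ρ.submatrix e e) :=
  ⟨hρ.1.submatrix e, by rw [trace_submatrix_equiv, hρ.2]⟩

theorem crossLog_submatrix (ρ : Matrix I I ℂ) {σ : Matrix I I ℂ} (hσ : σ.IsHermitian)
    (e : J ≃ I) : crossLog (ρ.submatrix e e) (σ.submatrix e e) = crossLog ρ σ := by
  rw [crossLog, cfc_submatrix hσ, Matrix.submatrix_mul_equiv, trace_submatrix_equiv, crossLog]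

theorem SuppLE.submatrix {ρ σ : Matrix I I ℂ} (h : SuppLE ρ σ) (e : J ≃ I) :
    SuppLE (ρ.submatrix e e) (σ.submatrix e e) := by
  intro v hv
  rw [Matrix.submatrix_mulVec_equiv] at hv ⊢
  have h1 : σ *ᵥ (v ∘ e.symm) = 0 := by
    ext i
    simpa using congrFun hv (e.symm i)
  rw [h _ h1]
  rfl

theorem traceNorm_submatrix (M : Matrix I I ℂ) (e : J ≃ I) :
    traceNorm (M.submatrix e e) = traceNorm M := by
  rw [traceNorm, Matrix.conjTranspose_submatrix, Matrix.submatrix_mul_equiv,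
    cfc_submatrix (Matrix.isHermitian_conjTranspose_mul_self M), trace_submatrix_equiv, traceNorm]

/-- Decomposition of a Hermitian operator into positive and negative parts. -/
theorem exists_posSemidef_sub {M : Matrix I I ℂ} (hM : M.IsHermitian) :
    ∃ P N : Matrix I I ℂ, P.PosSemidef ∧ N.PosSemidef ∧ M = P - N ∧
      N.trace.re ≤ traceNorm M := by
  obtain ⟨U, hU, μ, rfl⟩ := exists_conjDiag hM
  refine ⟨conjDiag U (fun i => max (μ i) 0), conjDiag U (fun i => max (-μ i) 0),
    posSemidef_conjDiag U fun i => le_max_right _ _,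
    posSemidef_conjDiag U fun i => le_max_right _ _, ?_, ?_⟩
  · rw [eq_sub_iff_add_eq, conjDiag_add]
    congr 1
    ext i
    rcases le_total (μ i) 0 with h | h <;> simp [h]
  · rw [traceNorm, isHermitian_conjDiag U μ, conjDiag_mul hU, cfc_conjDiag hU, trace_conjDiag hU,
      trace_conjDiag hU, Complex.re_sum, Complex.re_sum]
    refine Finset.sum_le_sum fun i _ => ?_
    rw [Complex.ofReal_re, Complex.ofReal_re, Pi.mul_apply, Real.sqrt_mul_self_eq_abs]
    exact max_le (neg_le_abs _) (abs_nonneg _)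

end Reindex

/-! ### Entropy of mixtures, relative entropy, and channels on states. -/

section StateLemmas

variable {I J : Type*} [Fintype I] [DecidableEq I] [Fintype J] [DecidableEq J]

theorem IsState.trace_re {ρ : Matrix I I ℂ} (hρ : IsState ρ) : ρ.trace.re = 1 := by
  rw [hρ.2, Complex.one_re]

theorem IsState.nonempty {ρ : Matrix I I ℂ} (hρ : IsState ρ) : Nonempty I := by
  by_contra h
  rw [not_nonempty_iff] at h
  have := hρ.2
  simp [Matrix.trace] at this

theorem convex_isState : Convex ℝ {ρ : Matrix I I ℂ | IsState ρ} := by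
  intro ρ hρ σ hσ s t hs ht hst
  refine ⟨(hρ.1.smul hs).add (hσ.1.smul ht), ?_⟩
  rw [Matrix.trace_add, Matrix.trace_smul, Matrix.trace_smul, hρ.2, hσ.2, ← add_smul, hst, one_smul]

theorem isState_inv_smul {P : Matrix I I ℂ} (hP : P.PosSemidef) {c : ℝ} (hc : 0 < c)
    (hT : P.trace.re = c) : IsState (c⁻¹ • P) := by
  refine ⟨hP.smul (inv_nonneg.2 hc.le), ?_⟩
  have h1 : P.trace = (c : ℂ) := by
    apply Complex.ext
    · rw [hT, Complex.ofReal_re]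
    · rw [Complex.ofReal_im]
      exact (Complex.le_def.1 hP.trace_nonneg).2.symm
  rw [Matrix.trace_smul, h1, Complex.real_smul, ← Complex.ofReal_mul, inv_mul_cancel₀ hc.ne',
    Complex.ofReal_one]

theorem isState_maxMixed [Nonempty I] :
    IsState ((Fintype.card I : ℝ)⁻¹ • (1 : Matrix I I ℂ)) :=
  isState_inv_smul Matrix.PosSemidef.one (by exact_mod_cast Fintype.card_pos)
    (by rw [Matrix.trace_one]; simp)

theorem mix_sub_left_posSemidef {ρ σ : Matrix I I ℂ} (hσ : σ.PosSemidef) {s t : ℝ} (ht : 0 ≤ t) :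
    (s • ρ + t • σ - s • ρ).PosSemidef := by
  rw [add_sub_cancel_left]
  exact hσ.smul ht

theorem suppLE_mix_left {ρ σ : Matrix I I ℂ} (hρ : ρ.PosSemidef) (hσ : σ.PosSemidef) {s t : ℝ}
    (hs : 0 < s) (ht : 0 ≤ t) : SuppLE ρ (s • ρ + t • σ) :=
  suppLE_of_posSemidef_sub hs hρ (mix_sub_left_posSemidef hσ ht)

/-- Concavity of the von Neumann entropy. -/
theorem crossLog_self_mix_le {ρ σ : Matrix I I ℂ} (hρ : IsState ρ) (hσ : IsState σ) {s t : ℝ}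
    (hs : 0 < s) (ht : 0 < t) (hst : s + t = 1) :
    crossLog (s • ρ + t • σ) (s • ρ + t • σ) ≤ s * crossLog ρ ρ + t * crossLog σ σ := by
  have hω : IsState (s • ρ + t • σ) := convex_isState hρ hσ hs.le ht.le hst
  have h1 := crossLog_le_self hρ.1 hω.1 (by rw [hρ.trace_re, hω.trace_re])
    (suppLE_mix_left hρ.1 hσ.1 hs ht.le)
  have h2 := crossLog_le_self hσ.1 hω.1 (by rw [hσ.trace_re, hω.trace_re])
    (by rw [add_comm]; exact suppLE_mix_left hσ.1 hρ.1 ht hs.le)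
  rw [crossLog_add, crossLog_smul, crossLog_smul]
  gcongr

/-- The binary entropy is at most one bit. This is the source of the additive `1` in both mixture
estimates for `E_r`. -/
theorem entropy_term_le_one {s t : ℝ} (hst : s + t = 1) :
    -1 ≤ s * Real.logb 2 s + t * Real.logb 2 t := by
  have h2 : 0 < Real.log 2 := Real.log_pos (by norm_num)
  have h1 := Real.binEntropy_le_log_two (p := s)
  obtain rfl : t = 1 - s := by linarith
  rw [Real.binEntropy, Real.log_inv, Real.log_inv] at h1
  simp only [Real.logb]
  rw [← mul_div_assoc, ← mul_div_assoc, ← add_div, le_div_iff₀ h2]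
  linarith

/-- The von Neumann entropy exceeds the average entropy of a two-term mixture by at most a bit. -/
theorem crossLog_self_mix_ge {ρ σ : Matrix I I ℂ} (hρ : IsState ρ) (hσ : IsState σ) {s t : ℝ}
    (hs : 0 < s) (ht : 0 < t) (hst : s + t = 1) :
    s * crossLog ρ ρ + t * crossLog σ σ - 1 ≤
      crossLog (s • ρ + t • σ) (s • ρ + t • σ) := by
  have hω : IsState (s • ρ + t • σ) := convex_isState hρ hσ hs.le ht.le hst
  have h1 := crossLog_ge_of_smul_le hρ.1 hω.1 hs (mix_sub_left_posSemidef hσ.1 ht.le)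
  have h2 := crossLog_ge_of_smul_le hσ.1 hω.1 ht
    (by rw [add_comm]; exact mix_sub_left_posSemidef hρ.1 hs.le)
  rw [hρ.trace_re, one_mul] at h1
  rw [hσ.trace_re, one_mul] at h2
  rw [crossLog_add, crossLog_smul, crossLog_smul]
  have h3 := mul_le_mul_of_nonneg_left h1 hs.le
  have h4 := mul_le_mul_of_nonneg_left h2 ht.le
  have h5 := entropy_term_le_one hst
  linarith

theorem relEntropy_nonneg {ρ σ : Matrix I I ℂ} (hρ : IsState ρ) (hσ : IsState σ) :
    0 ≤ relEntropy ρ σ := by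
  by_cases h : SuppLE ρ σ
  · rw [relEntropy_of_suppLE h]
    have := crossLog_le_self hρ.1 hσ.1 (by rw [hρ.trace_re, hσ.trace_re]) h
    exact_mod_cast sub_nonneg.2 this
  · rw [relEntropy_of_not_suppLE h]
    exact le_top

theorem relEntropy_submatrix {ρ σ : Matrix I I ℂ} (hρ : ρ.IsHermitian) (hσ : σ.IsHermitian)
    (e : J ≃ I) : relEntropy (ρ.submatrix e e) (σ.submatrix e e) = relEntropy ρ σ := by
  by_cases h : SuppLE ρ σ
  · rw [relEntropy_of_suppLE h, relEntropy_of_suppLE (h.submatrix e), crossLog_submatrix _ hρ,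
      crossLog_submatrix _ hσ]
  · rw [relEntropy_of_not_suppLE h, relEntropy_of_not_suppLE]
    intro h'
    have := h'.submatrix e.symm
    simp only [Matrix.submatrix_submatrix, Equiv.self_comp_symm, Matrix.submatrix_id_id] at this
    exact h this

theorem IsChannel.isState {Λ : Matrix I I ℂ →ₗ[ℂ] Matrix J J ℂ} (hΛ : IsChannel Λ)
    {ρ : Matrix I I ℂ} (hρ : IsState ρ) : IsState (Λ ρ) := by
  refine ⟨?_, by rw [hΛ.2, hρ.2]⟩
  -- Positivity is complete positivity with a one-dimensional ancilla.
  exact (hΛ.1 1 _ (hρ.1.submatrix Prod.fst)).submatrix (fun j : J => (j, (0 : Fin 1)))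

end StateLemmas

/-! ### Separable states and asymptotic continuity of `E_r`. -/

section Separable

variable {A B A' B' : Type*} [Fintype A] [DecidableEq A] [Fintype B] [DecidableEq B]
  [Fintype A'] [DecidableEq A'] [Fintype B'] [DecidableEq B']

theorem isSeparable_kronecker {α : Matrix A A ℂ} {β : Matrix B B ℂ} (hα : IsState α)
    (hβ : IsState β) : IsSeparable (α ⊗ₖ β) :=
  subset_convexHull _ _ ⟨α, β, hα, hβ, rfl⟩

/-- Induction principle: a property stable under mixing need only be checked on product states. -/
theorem IsSeparable.of_convex {S : Set (Matrix (A × B) (A × B) ℂ)} (hS : Convex ℝ S)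
    (h : ∀ (α : Matrix A A ℂ) (β : Matrix B B ℂ), IsState α → IsState β → α ⊗ₖ β ∈ S)
    {τ : Matrix (A × B) (A × B) ℂ} (hτ : IsSeparable τ) : τ ∈ S := by
  refine convexHull_min ?_ hS hτ
  rintro _ ⟨α, β, hα, hβ, rfl⟩
  exact h α β hα hβ

theorem IsSeparable.isState {τ : Matrix (A × B) (A × B) ℂ} (hτ : IsSeparable τ) : IsState τ :=
  hτ.of_convex convex_isState fun _ _ hα hβ => hα.kronecker hβ

theorem IsSeparable.mix {τ τ' : Matrix (A × B) (A × B) ℂ} (hτ : IsSeparable τ)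
    (hτ' : IsSeparable τ') {s t : ℝ} (hs : 0 ≤ s) (ht : 0 ≤ t) (hst : s + t = 1) :
    IsSeparable (s • τ + t • τ') :=
  convex_convexHull ℝ _ hτ hτ' hs ht hst

theorem isSeparable_maxMixed [Nonempty A] [Nonempty B] :
    IsSeparable ((Fintype.card (A × B) : ℝ)⁻¹ • (1 : Matrix (A × B) (A × B) ℂ)) := by
  have := isSeparable_kronecker (isState_maxMixed (I := A)) (isState_maxMixed (I := B))
  rwa [Matrix.smul_kronecker, Matrix.kronecker_smul, Matrix.one_kronecker_one, smul_smul,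
    ← mul_inv, ← Nat.cast_mul, ← Fintype.card_prod] at this

theorem IsSeparable.submatrix {τ : Matrix (A × B) (A × B) ℂ} (hτ : IsSeparable τ) (e : A' ≃ A)
    (f : B' ≃ B) : IsSeparable (τ.submatrix (e.prodCongr f) (e.prodCongr f)) := by
  refine hτ.of_convex (S := {τ | IsSeparable (τ.submatrix (e.prodCongr f) (e.prodCongr f))}) ?_ ?_
  · intro τ hτ τ' hτ' s t hs ht hst
    exact IsSeparable.mix hτ hτ' hs ht hst
  · intro α β hα hβ
    exact isSeparable_kronecker (hα.submatrix e) (hβ.submatrix f)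

theorem IsSeparable.kronecker {τ : Matrix (A × B) (A × B) ℂ} {τ' : Matrix (A' × B') (A' × B') ℂ}
    (hτ : IsSeparable τ) (hτ' : IsSeparable τ') :
    IsSeparable ((τ ⊗ₖ τ').submatrix (Equiv.prodProdProdComm A A' B B')
      (Equiv.prodProdProdComm A A' B B')) := by
  refine hτ.of_convex (S := {τ | IsSeparable ((τ ⊗ₖ τ').submatrix
    (Equiv.prodProdProdComm A A' B B') (Equiv.prodProdProdComm A A' B B'))}) ?_ ?_
  · intro τ₁ h₁ τ₂ h₂ s t hs ht hst
    rw [Set.mem_ofPred_eq, Matrix.add_kronecker, Matrix.smul_kronecker, Matrix.smul_kronecker]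
    exact IsSeparable.mix h₁ h₂ hs ht hst
  intro α β hα hβ
  refine hτ'.of_convex (S := {τ' | IsSeparable (((α ⊗ₖ β) ⊗ₖ τ').submatrix
    (Equiv.prodProdProdComm A A' B B') (Equiv.prodProdProdComm A A' B B'))}) ?_ ?_
  · intro τ₁ h₁ τ₂ h₂ s t hs ht hst
    rw [Set.mem_ofPred_eq, Matrix.kronecker_add, Matrix.kronecker_smul, Matrix.kronecker_smul]
    exact IsSeparable.mix h₁ h₂ hs ht hst
  intro α' β' hα' hβ'
  have := isSeparable_kronecker (hα.kronecker hα') (hβ.kronecker hβ')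
  rw [Set.mem_ofPred_eq]
  convert this using 1
  ext x y
  simp only [Matrix.submatrix_apply, Matrix.kroneckerMap_apply, Equiv.prodProdProdComm_apply]
  ring

theorem relEntEntanglement_le {ρ σ : Matrix (A × B) (A × B) ℂ} (hσ : IsSeparable σ) :
    relEntEntanglement ρ ≤ relEntropy ρ σ := iInf₂_le σ hσ

theorem relEntEntanglement_nonneg {ρ : Matrix (A × B) (A × B) ℂ} (hρ : IsState ρ) :
    0 ≤ relEntEntanglement ρ :=
  le_iInf₂ fun _ hσ => relEntropy_nonneg hρ hσ.isState

theorem relEntEntanglement_lt_top {ρ : Matrix (A × B) (A × B) ℂ} (hρ : IsState ρ) :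
    relEntEntanglement ρ < ⊤ := by
  obtain ⟨a, b⟩ := hρ.nonempty.some
  have : Nonempty A := ⟨a⟩
  have : Nonempty B := ⟨b⟩
  refine (relEntEntanglement_le isSeparable_maxMixed).trans_lt ?_
  have h0 : (0 : ℝ) < (Fintype.card (A × B) : ℝ)⁻¹ :=
    inv_pos.2 (by exact_mod_cast Fintype.card_pos)
  have h := suppLE_mix (ρ := ρ) (τ := 0) Matrix.PosSemidef.zero (s := 0) le_rfl h0
  rw [smul_zero, zero_add] at h
  rw [relEntropy_of_suppLE h]
  exact EReal.coe_lt_top _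

/-- The relative entropy of entanglement as a real number. -/
noncomputable def entReal (ρ : Matrix (A × B) (A × B) ℂ) : ℝ := (relEntEntanglement ρ).toReal

theorem coe_entReal {ρ : Matrix (A × B) (A × B) ℂ} (hρ : IsState ρ) :
    (entReal ρ : EReal) = relEntEntanglement ρ :=
  EReal.coe_toReal (relEntEntanglement_lt_top hρ).ne
    (EReal.bot_lt_zero.trans_le (relEntEntanglement_nonneg hρ)).ne'

theorem entReal_nonneg {ρ : Matrix (A × B) (A × B) ℂ} (hρ : IsState ρ) : 0 ≤ entReal ρ :=
  EReal.toReal_nonneg (relEntEntanglement_nonneg hρ)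

theorem entReal_le {ρ σ : Matrix (A × B) (A × B) ℂ} (hρ : IsState ρ) (hσ : IsSeparable σ)
    (h : SuppLE ρ σ) : entReal ρ ≤ crossLog ρ ρ - crossLog ρ σ := by
  rw [← EReal.coe_le_coe_iff, coe_entReal hρ, ← relEntropy_of_suppLE h]
  exact relEntEntanglement_le hσ

theorem exists_of_entReal_lt {ρ : Matrix (A × B) (A × B) ℂ} (hρ : IsState ρ) {x : ℝ}
    (hx : entReal ρ < x) :
    ∃ σ, IsSeparable σ ∧ SuppLE ρ σ ∧ crossLog ρ ρ - crossLog ρ σ < x := by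
  rw [← EReal.coe_lt_coe_iff, coe_entReal hρ, relEntEntanglement, iInf_lt_iff] at hx
  obtain ⟨σ, hx⟩ := hx
  obtain ⟨hσ, hx⟩ := iInf_lt_iff.1 hx
  have h : SuppLE ρ σ := by
    by_contra h
    rw [relEntropy_of_not_suppLE h] at hx
    exact not_top_lt hx
  rw [relEntropy_of_suppLE h] at hx
  exact ⟨σ, hσ, h, by exact_mod_cast hx⟩

theorem le_entReal {ρ : Matrix (A × B) (A × B) ℂ} (hρ : IsState ρ) {x : ℝ}
    (h : ∀ σ, IsSeparable σ → SuppLE ρ σ → x ≤ crossLog ρ ρ - crossLog ρ σ) : x ≤ entReal ρ := by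
  by_contra! hx
  obtain ⟨σ, hσ, hs, hlt⟩ := exists_of_entReal_lt hρ hx
  exact (h σ hσ hs).not_gt hlt

theorem relEntEntanglement_submatrix_le {ρ : Matrix (A × B) (A × B) ℂ} (hρ : IsState ρ)
    (e : A' ≃ A) (f : B' ≃ B) :
    relEntEntanglement (ρ.submatrix (e.prodCongr f) (e.prodCongr f)) ≤ relEntEntanglement ρ := by
  refine le_iInf₂ fun σ hσ => ?_
  rw [← relEntropy_submatrix hρ.1.1 hσ.isState.1.1 (e.prodCongr f)]
  exact relEntEntanglement_le (hσ.submatrix e f)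

theorem relEntEntanglement_submatrix {ρ : Matrix (A × B) (A × B) ℂ} (hρ : IsState ρ)
    (e : A' ≃ A) (f : B' ≃ B) :
    relEntEntanglement (ρ.submatrix (e.prodCongr f) (e.prodCongr f)) = relEntEntanglement ρ := by
  refine le_antisymm (relEntEntanglement_submatrix_le hρ e f) ?_
  have := relEntEntanglement_submatrix_le (hρ.submatrix (e.prodCongr f)) e.symm f.symm
  rw [Matrix.submatrix_submatrix] at this
  have h : (e.prodCongr f : A' × B' → A × B) ∘ (e.symm.prodCongr f.symm) = id := by
    ext x <;> simp
  rwa [h, Matrix.submatrix_id_id] at this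

/-- Subadditivity of the relative entropy of entanglement under tensor products. -/
theorem entReal_kronecker_le {ρ : Matrix (A × B) (A × B) ℂ} {ρ' : Matrix (A' × B') (A' × B') ℂ}
    (hρ : IsState ρ) (hρ' : IsState ρ') :
    entReal ((ρ ⊗ₖ ρ').submatrix (Equiv.prodProdProdComm A A' B B')
      (Equiv.prodProdProdComm A A' B B')) ≤ entReal ρ + entReal ρ' := by
  refine le_of_forall_pos_le_add fun ε hε => ?_
  obtain ⟨σ, hσ, hs, hlt⟩ := exists_of_entReal_lt hρ (lt_add_of_pos_right _ (half_pos hε))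
  obtain ⟨σ', hσ', hs', hlt'⟩ := exists_of_entReal_lt hρ' (lt_add_of_pos_right _ (half_pos hε))
  have hk := (hs.kronecker hσ.isState.1 hσ'.isState.1 hs')
  have h1 := entReal_le ((hρ.kronecker hρ').submatrix (Equiv.prodProdProdComm A A' B B'))
    (hσ.kronecker hσ') (hk.submatrix _)
  rw [crossLog_submatrix _ (hρ.kronecker hρ').1.1,
    crossLog_submatrix _ (hσ.isState.kronecker hσ'.isState).1.1,
    crossLog_kronecker hρ hρ' hσ.isState.1 hσ'.isState.1 hs hs',
    crossLog_kronecker hρ hρ' hρ.1 hρ'.1 (suppLE_refl _) (suppLE_refl _)] at h1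
  linarith

theorem logb_card_nonneg [Nonempty A] : 0 ≤ Real.logb 2 (Fintype.card A) :=
  Real.logb_nonneg (by norm_num) (by exact_mod_cast Fintype.card_pos)

/-- The trial state is `s τ + t · 1/d` with `τ` nearly optimal for `ρ`. The `τ` part handles `ρ` at
cost `log (1/s)`, the maximally mixed part handles `Δ` at cost `log (d/t)`; averaged, the costs are
`t log d` plus a binary entropy. -/
theorem entReal_mix_le {ρ Δ : Matrix (A × B) (A × B) ℂ} (hρ : IsState ρ) (hΔ : IsState Δ)
    {s t : ℝ} (hs : 0 < s) (ht : 0 < t) (hst : s + t = 1) :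
    entReal (s • ρ + t • Δ) ≤
      s * entReal ρ + t * Real.logb 2 (Fintype.card (A × B)) + 1 := by
  obtain ⟨a, b⟩ := hρ.nonempty.some
  have : Nonempty A := ⟨a⟩
  have : Nonempty B := ⟨b⟩
  set d : ℝ := (Fintype.card (A × B) : ℝ) with hd
  have hd0 : 0 < d := by rw [hd]; exact_mod_cast Fintype.card_pos
  have hω : IsState (s • ρ + t • Δ) := convex_isState hρ hΔ hs.le ht.le hst
  refine le_of_forall_pos_le_add fun ε hε => ?_
  obtain ⟨τ, hτ, hsup, hlt⟩ := exists_of_entReal_lt hρ (lt_add_of_pos_right _ hε)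
  have hτ' := hτ.mix (isSeparable_maxMixed (A := A) (B := B)) hs.le ht.le hst
  rw [smul_smul, ← hd] at hτ'
  have htd : 0 < t * d⁻¹ := by positivity
  have h1 := entReal_le hω hτ' (suppLE_mix hτ.isState.1 hs.le htd)
  have h2 := crossLog_mix_ge hρ.1 hτ.isState.1 hsup hs htd.le
  have h3 := trace_mul_logb_le_crossLog_mix hΔ.1 hτ.isState.1 hs.le htd
  have h4 := crossLog_self_mix_le hρ hΔ hs ht hst
  have h5 := crossLog_self_nonpos hΔ
  have h6 := entropy_term_le_one hst
  rw [crossLog_add _ _ (s • τ + _), crossLog_smul, crossLog_smul] at h1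
  rw [hρ.trace_re, one_mul] at h2
  rw [hΔ.trace_re, one_mul, Real.logb_mul ht.ne' (inv_ne_zero hd0.ne'), Real.logb_inv] at h3
  have h7 := mul_le_mul_of_nonneg_left h2 hs.le
  have h8 := mul_le_mul_of_nonneg_left h3 ht.le
  have h9 := mul_le_mul_of_nonneg_left hlt.le hs.le
  have h10 := mul_nonpos_of_nonneg_of_nonpos ht.le h5
  have h11 : s * ε ≤ ε := by nlinarith
  linarith

/-- Any separable `τ` for the mixture also serves for `ρ`. The `Δ` contribution to the relative
entropy is nonnegative, and splitting the entropy of the mixture costs at most one bit. -/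
theorem entReal_mix_ge {ρ Δ : Matrix (A × B) (A × B) ℂ} (hρ : IsState ρ) (hΔ : IsState Δ)
    {s t : ℝ} (hs : 0 < s) (ht : 0 < t) (hst : s + t = 1) :
    s * entReal ρ - 1 ≤ entReal (s • ρ + t • Δ) := by
  have hω : IsState (s • ρ + t • Δ) := convex_isState hρ hΔ hs.le ht.le hst
  refine le_entReal hω fun τ hτ hsup => ?_
  have hρτ : SuppLE ρ τ := (suppLE_mix_left hρ.1 hΔ.1 hs ht.le).trans hsup
  have hΔτ : SuppLE Δ τ :=
    SuppLE.trans (by rw [add_comm]; exact suppLE_mix_left hΔ.1 hρ.1 ht hs.le) hsup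
  have h1 := crossLog_self_mix_ge hρ hΔ hs ht hst
  have h2 := crossLog_le_self hΔ.1 hτ.isState.1 (by rw [hΔ.trace_re, hτ.isState.trace_re]) hΔτ
  have h3 := entReal_le hρ hτ hρτ
  have h4 := mul_le_mul_of_nonneg_left h3 hs.le
  have h5 := mul_le_mul_of_nonneg_left h2 ht.le
  rw [crossLog_add (s • ρ) (t • Δ) τ, crossLog_smul, crossLog_smul]
  linarith

/-- Asymptotic continuity of the relative entropy of entanglement. -/
theorem entReal_le_of_traceNorm_le {ρ σ : Matrix (A × B) (A × B) ℂ} (hρ : IsState ρ)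
    (hσ : IsState σ) {δ : ℝ} (hδ : δ ≤ 1) (h : traceNorm (ρ - σ) ≤ δ) :
    entReal σ ≤ entReal ρ + δ * Real.logb 2 (Fintype.card (A × B)) + 4 := by
  have := hρ.nonempty
  obtain ⟨P, N, hP, hN, hPN, hNT⟩ := exists_posSemidef_sub (hρ.1.1.sub hσ.1.1)
  have hlog := logb_card_nonneg (A := A × B)
  have hTT : P.trace.re = N.trace.re := by
    have := congrArg (fun X => (Matrix.trace X).re) hPN
    simp only [Matrix.trace_sub, Complex.sub_re, hρ.trace_re, hσ.trace_re] at this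
    linarith
  have hNδ := hNT.trans h
  have hN0 : 0 ≤ N.trace.re := (Complex.le_def.1 hN.trace_nonneg).1
  set κ := N.trace.re with hκ
  rcases hN0.eq_or_lt with h0 | h0
  -- If `κ = 0`, both parts vanish and the states coincide; `κ⁻¹ • N` is a state only for `κ > 0`.
  · have htr : ∀ Q : Matrix (A × B) (A × B) ℂ, Q.PosSemidef → Q.trace.re = 0 → Q = 0 := by
      intro Q hQ hre
      rw [← hQ.trace_eq_zero_iff]
      exact Complex.ext hre (Complex.le_def.1 hQ.trace_nonneg).2.symm
    rw [htr P hP (hTT.trans h0.symm), htr N hN h0.symm, sub_zero, sub_eq_zero] at hPN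
    rw [hPN]
    nlinarith
  have hs : 0 < (1 + κ)⁻¹ := by positivity
  have ht : 0 < (1 + κ)⁻¹ * κ := by positivity
  have hst : (1 + κ)⁻¹ + (1 + κ)⁻¹ * κ = 1 := by field_simp
  have hΔ := isState_inv_smul hN h0 rfl
  have hΔ' := isState_inv_smul hP h0 hTT
  have h1 := entReal_mix_le hρ hΔ hs ht hst
  have h2 := entReal_mix_ge hσ hΔ' hs ht hst
  have heq : (1 + κ)⁻¹ • ρ + ((1 + κ)⁻¹ * κ) • (κ⁻¹ • N) =
      (1 + κ)⁻¹ • σ + ((1 + κ)⁻¹ * κ) • (κ⁻¹ • P) := by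
    rw [smul_smul, smul_smul, mul_assoc, mul_inv_cancel₀ h0.ne', mul_one, ← smul_add, ← smul_add]
    congr 1
    rw [sub_eq_sub_iff_add_eq_add] at hPN
    rw [hPN, add_comm]
  rw [heq] at h1
  -- Clearing the factor `1 + κ` turns the two one-bit errors into `2 (1 + κ) ≤ 4`, as `κ ≤ δ ≤ 1`.
  have h3 := mul_le_mul_of_nonneg_left (h2.trans h1) (by positivity : 0 ≤ 1 + κ)
  have h4 : (1 + κ) * ((1 + κ)⁻¹ * entReal σ - 1) = entReal σ - (1 + κ) := by field_simp
  have h5 : (1 + κ) * ((1 + κ)⁻¹ * entReal ρ +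
      (1 + κ)⁻¹ * κ * Real.logb 2 (Fintype.card (A × B)) + 1) =
      entReal ρ + κ * Real.logb 2 (Fintype.card (A × B)) + (1 + κ) := by field_simp
  rw [h4, h5] at h3
  have h6 := mul_le_mul_of_nonneg_right hNδ hlog
  linarith

end Separable

/-! ### Regularization and the bipartite rate bound. -/

section TensorPower

variable {A B A' B' : Type*} [Fintype A] [DecidableEq A] [Fintype B] [DecidableEq B]
  [Fintype A'] [DecidableEq A'] [Fintype B'] [DecidableEq B']

/-- Splitting `m + n` copies of a system into `m` and `n` copies. -/
def splitEquiv (A : Type*) (m n : ℕ) : (Fin (m + n) → A) ≃ (Fin m → A) × (Fin n → A) :=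
  (Fin.appendEquiv m n).symm

theorem tensorPower_add (ρ : Matrix (A × B) (A × B) ℂ) (m n : ℕ) :
    tensorPower ρ (m + n) =
      ((tensorPower ρ m ⊗ₖ tensorPower ρ n).submatrix
        (Equiv.prodProdProdComm (Fin m → A) (Fin n → A) (Fin m → B) (Fin n → B))
        (Equiv.prodProdProdComm (Fin m → A) (Fin n → A) (Fin m → B) (Fin n → B))).submatrix
        ((splitEquiv A m n).prodCongr (splitEquiv B m n))
        ((splitEquiv A m n).prodCongr (splitEquiv B m n)) := by
  ext x y
  simp only [tensorPower, Matrix.of_apply, Fin.prod_univ_add]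
  rfl

theorem isState_tensorPower {ρ : Matrix (A × B) (A × B) ℂ} (hρ : IsState ρ) (n : ℕ) :
    IsState (tensorPower ρ n) := by
  induction n with
  | zero =>
    have : tensorPower ρ 0 = 1 := by
      ext x y
      rw [Subsingleton.elim x y]
      simp [tensorPower]
    rw [this]
    exact ⟨Matrix.PosSemidef.one, by simp⟩
  | succ n ih =>
    have h1 : IsState (tensorPower ρ 1) := by
      have : tensorPower ρ 1 = ρ.submatrix
          ((Equiv.funUnique (Fin 1) A).prodCongr (Equiv.funUnique (Fin 1) B))
          ((Equiv.funUnique (Fin 1) A).prodCongr (Equiv.funUnique (Fin 1) B)) := by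
        ext x y
        simp [tensorPower]
        rfl
      rw [this]
      exact hρ.submatrix _
    rw [tensorPower_add]
    exact ((ih.kronecker h1).submatrix _).submatrix _

theorem entReal_submatrix {ρ : Matrix (A × B) (A × B) ℂ} (hρ : IsState ρ)
    (e : A' ≃ A) (f : B' ≃ B) :
    entReal (ρ.submatrix (e.prodCongr f) (e.prodCongr f)) = entReal ρ := by
  rw [entReal, relEntEntanglement_submatrix hρ, entReal]

theorem subadditive_entReal {ρ : Matrix (A × B) (A × B) ℂ} (hρ : IsState ρ) :
    Subadditive fun n => entReal (tensorPower ρ n) := by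
  intro m n
  have hm := isState_tensorPower hρ m
  have hn := isState_tensorPower hρ n
  change entReal (tensorPower ρ (m + n)) ≤ _
  rw [tensorPower_add, entReal_submatrix ((hm.kronecker hn).submatrix _)]
  exact entReal_kronecker_le hm hn

theorem entanglementPerCopy_eq {ρ : Matrix (A × B) (A × B) ℂ} (hρ : IsState ρ) (n : ℕ) :
    entanglementPerCopy ρ n = ((entReal (tensorPower ρ n) / n : ℝ) : EReal) := by
  rw [entanglementPerCopy, ← coe_entReal (isState_tensorPower hρ n), EReal.coe_div]
  rfl

theorem exists_regRelEnt {ρ : Matrix (A × B) (A × B) ℂ} (hρ : IsState ρ) :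
    ∃ L : ℝ, 0 ≤ L ∧ Tendsto (fun n : ℕ => entReal (tensorPower ρ n) / n) atTop (𝓝 L) ∧
      Tendsto (entanglementPerCopy ρ) atTop (𝓝 (L : EReal)) ∧ regRelEnt ρ = L := by
  have hnn : ∀ n : ℕ, 0 ≤ entReal (tensorPower ρ n) / n := fun n =>
    div_nonneg (entReal_nonneg (isState_tensorPower hρ n)) n.cast_nonneg
  -- Fekete's lemma; nonnegativity of `E_r` supplies the lower bound it needs.
  have h := (subadditive_entReal hρ).tendsto_lim ⟨0, by rintro _ ⟨n, rfl⟩; exact hnn n⟩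
  have h' : Tendsto (entanglementPerCopy ρ) atTop
      (𝓝 (((subadditive_entReal hρ).lim : ℝ) : EReal)) := by
    rw [funext (entanglementPerCopy_eq hρ)]
    exact (continuous_coe_real_ereal.tendsto _).comp h
  exact ⟨_, ge_of_tendsto' h hnn, h, h', h'.limUnder_eq⟩

theorem regRelEnt_exists_nonneg_lt_top {ρ : Matrix (A × B) (A × B) ℂ} (hρ : IsState ρ) :
    Tendsto (entanglementPerCopy ρ) atTop (𝓝 (regRelEnt ρ)) ∧
      0 ≤ regRelEnt ρ ∧ regRelEnt ρ < ⊤ := by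
  obtain ⟨L, hL, -, h, heq⟩ := exists_regRelEnt hρ
  rw [heq]
  exact ⟨h, by exact_mod_cast hL, EReal.coe_lt_top L⟩

/-- Passage to the limit, with `C` the log-dimension per copy. Good `n` only occur infinitely often,
so the argument is by contradiction at one sufficiently large `n`. -/
theorem mul_le_of_frequently_le {u v : ℕ → ℝ} {L K C : ℝ} {r : ℝ≥0} (hL : 0 ≤ L) (hC : 0 ≤ C)
    (hu : Tendsto (fun n : ℕ => u n / n) atTop (𝓝 L))
    (hv : Tendsto (fun n : ℕ => v n / n) atTop (𝓝 K))
    (h : ∀ δ : ℝ, 0 < δ → δ ≤ 1 → ∀ N : ℕ, ∃ n ≥ N,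
      v ⌊r * n⌋₊ ≤ u n + 1 + δ * (⌊r * n⌋₊ * C) + 4) : r * K ≤ L := by
  rcases eq_or_ne r 0 with rfl | hr
  -- For `r = 0` the output size stays `0`, so the limit of `v` along `⌊r * n⌋₊` would be
  -- unavailable.
  · simpa using hL
  have hr : (0 : ℝ) < r := NNReal.coe_pos.2 (pos_iff_ne_zero.2 hr)
  have hfl : ∀ n : ℕ, ⌊r * n⌋₊ = ⌊(r : ℝ) * n⌋₊ := fun n =>
    (Nonneg.nat_floor_coe (r * (n : ℝ≥0))).symm
  simp only [hfl] at h
  have hdiv : Tendsto (fun n : ℕ => (⌊(r : ℝ) * n⌋₊ : ℝ) / n) atTop (𝓝 (r : ℝ)) :=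
    (tendsto_nat_floor_mul_div_atTop hr.le).comp tendsto_natCast_atTop_atTop
  have htop : Tendsto (fun n : ℕ => ⌊(r : ℝ) * n⌋₊) atTop atTop :=
    tendsto_nat_floor_atTop.comp (tendsto_natCast_atTop_atTop.const_mul_atTop hr)
  have hvr : Tendsto (fun n : ℕ => v ⌊(r : ℝ) * n⌋₊ / n) atTop (𝓝 (K * r)) := by
    refine ((hv.comp htop).mul hdiv).congr' ?_
    filter_upwards [htop.eventually_gt_atTop 0] with n hn
    have : (⌊(r : ℝ) * n⌋₊ : ℝ) ≠ 0 := by exact_mod_cast hn.ne'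
    simp only [Function.comp_apply]
    field_simp
  have h5 : Tendsto (fun n : ℕ => (5 : ℝ) / n) atTop (𝓝 0) :=
    tendsto_const_div_atTop_nhds_zero_nat 5
  by_contra! hlt
  -- The gap is split in four: the errors in `u n / n` and `v ⌊r n⌋₊ / n`, the constant `1 + 4`, and
  -- the continuity term, made at most `η n` by the choice of `δ`.
  obtain ⟨η, hη, hη'⟩ : ∃ η : ℝ, 0 < η ∧ 4 * η = r * K - L :=
    ⟨(r * K - L) / 4, by linarith, by ring⟩
  obtain ⟨N, hN⟩ := eventually_atTop.1
    (((hu.eventually_lt_const (lt_add_of_pos_right L hη)).and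
      (hvr.eventually_const_lt (sub_lt_self (K * r) hη))).and
      ((h5.eventually_lt_const hη).and (eventually_gt_atTop 0)))
  have hden : 0 < r * C + 1 := by positivity
  have hδ : 0 < min 1 (η / (r * C + 1)) := by positivity
  obtain ⟨n, hn, hle⟩ := h _ hδ (min_le_left _ _) N
  obtain ⟨⟨h1, h2⟩, h3, h4⟩ := hN n hn
  have hn0 : (0 : ℝ) < n := by exact_mod_cast h4
  have h6 : min 1 (η / (r * C + 1)) * (⌊(r : ℝ) * n⌋₊ * C) ≤ η * n := by
    calc _ ≤ η / (r * C + 1) * ((r * n) * C) := by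
          gcongr
          · exact min_le_right _ _
          · exact Nat.floor_le (by positivity)
      _ = η * n * ((r * C) / (r * C + 1)) := by ring
      _ ≤ η * n * 1 := by
          gcongr
          rw [div_le_one hden]
          linarith
      _ = η * n := mul_one _
  rw [div_lt_iff₀ hn0] at h1 h3
  rw [lt_div_iff₀ hn0] at h2
  nlinarith

theorem tensorPower_card_logb (m : ℕ) :
    Real.logb 2 (Fintype.card ((Fin m → A) × (Fin m → B))) =
      m * Real.logb 2 (Fintype.card (A × B)) := by
  rw [← Real.logb_pow]
  congr 1
  simp [mul_pow]

theorem coe_le_div_of_mul_le {r L K : ℝ} (hK : 0 < K) (h : r * K ≤ L) :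
    (r : EReal) ≤ (L : EReal) / (K : EReal) := by
  rw [← EReal.coe_div, EReal.coe_le_coe_iff, le_div_iff₀ hK]
  exact h

theorem entReal_le_add_of_relEntEntanglement_le {ρ : Matrix (A × B) (A × B) ℂ}
    {σ : Matrix (A' × B') (A' × B') ℂ} (hρ : IsState ρ) (hσ : IsState σ) {ε : ℝ}
    (h : relEntEntanglement σ ≤ relEntEntanglement ρ + (ε : EReal)) :
    entReal σ ≤ entReal ρ + ε := by
  rw [← coe_entReal hρ, ← coe_entReal hσ, ← EReal.coe_add, EReal.coe_le_coe_iff] at h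
  exact h

theorem rate_le {ρ : Matrix (A × B) (A × B) ℂ} {σ : Matrix (A' × B') (A' × B') ℂ}
    (hρ : IsState ρ) (hσ : IsState σ) (hpos : 0 < regRelEnt σ) :
    rate ρ σ ≤ regRelEnt ρ / regRelEnt σ := by
  obtain ⟨L, hL, hu, -, hLeq⟩ := exists_regRelEnt hρ
  obtain ⟨K, hK, hv, -, hKeq⟩ := exists_regRelEnt hσ
  rw [hKeq] at hpos
  have hK0 : 0 < K := by exact_mod_cast hpos
  rw [hLeq, hKeq]
  refine iSup₂_le fun r hr => coe_le_div_of_mul_le hK0 ?_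
  obtain ⟨Λ, hΛ, h⟩ := hr
  have := hσ.nonempty
  refine mul_le_of_frequently_le hL (logb_card_nonneg (A := A' × B')) hu hv ?_
  intro δ hδ hδ1 N
  -- `ε = 1` suffices: a bounded increase of `E_r` vanishes after division by `n`.
  obtain ⟨n, hn, h1, h2⟩ := h 1 one_pos δ hδ N
  refine ⟨n, hn, ?_⟩
  have hρn := isState_tensorPower hρ n
  have h3 := entReal_le_add_of_relEntEntanglement_le hρn ((hΛ n).isState hρn) (h1 _ hρn)
  have h4 := entReal_le_of_traceNorm_le ((hΛ n).isState hρn) (isState_tensorPower hσ _) hδ1 h2.le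
  rw [tensorPower_card_logb] at h4
  linarith

end TensorPower

/-! ### Reduction of the multipartite bound to a single cut. -/

section Multipartite

variable {ι : Type*} [Fintype ι] [DecidableEq ι]
  {X : ι → Type*} [∀ p, Fintype (X p)] [∀ p, DecidableEq (X p)]
  {Y : ι → Type*} [∀ p, Fintype (Y p)] [∀ p, DecidableEq (Y p)]

theorem cut_eq_submatrix (T : Finset ι) (ρ : Matrix (∀ p, X p) (∀ p, X p) ℂ) :
    cut T ρ = ρ.submatrix (Equiv.piEquivPiSubtypeProd (· ∈ T) X).symm
      (Equiv.piEquivPiSubtypeProd (· ∈ T) X).symm := rfl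

theorem IsState.cut {ρ : Matrix (∀ p, X p) (∀ p, X p) ℂ} (hρ : IsState ρ) (T : Finset ι) :
    IsState (cut T ρ) :=
  hρ.submatrix (Equiv.piEquivPiSubtypeProd (· ∈ T) X).symm

theorem traceNorm_cut (T : Finset ι) (M : Matrix (∀ p, X p) (∀ p, X p) ℂ) :
    traceNorm (cut T M) = traceNorm M :=
  traceNorm_submatrix M _

/-- Cutting `n` copies of a multipartite operator amounts to taking `n` copies of the cut
operator. -/
theorem cut_multiTensorPower (T : Finset ι) (ρ : Matrix (∀ p, X p) (∀ p, X p) ℂ) (n : ℕ) :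
    cut T (multiTensorPower ρ n) = (tensorPower (cut T ρ) n).submatrix
      ((Equiv.piComm fun (p : {p // p ∈ T}) (_ : Fin n) => X p).prodCongr
        (Equiv.piComm fun (p : {p // p ∉ T}) (_ : Fin n) => X p))
      ((Equiv.piComm fun (p : {p // p ∈ T}) (_ : Fin n) => X p).prodCongr
        (Equiv.piComm fun (p : {p // p ∉ T}) (_ : Fin n) => X p)) := by
  have key : ∀ (x : (∀ p : {p // p ∈ T}, Fin n → X p) × (∀ p : {p // p ∉ T}, Fin n → X p))
      (k : Fin n), (fun p => (Equiv.piEquivPiSubtypeProd (· ∈ T) fun p => Fin n → X p).symm x p k) =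
      (Equiv.piEquivPiSubtypeProd (· ∈ T) X).symm (fun p => x.1 p k, fun p => x.2 p k) := by
    intro x k
    ext p
    by_cases hp : p ∈ T <;> simp [Equiv.piEquivPiSubtypeProd_symm_apply, hp]
  ext x y
  simp only [cut_eq_submatrix, Matrix.submatrix_apply, multiTensorPower, tensorPower,
    Matrix.of_apply, key]
  rfl

theorem isState_multiTensorPower {ρ : Matrix (∀ p, X p) (∀ p, X p) ℂ} (hρ : IsState ρ) (n : ℕ) :
    IsState (multiTensorPower ρ n) := by
  -- Cutting along `∅` only relabels, so the bipartite statement about tensor powers applies.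
  have h : IsState (cut ∅ (multiTensorPower ρ n)) := by
    rw [cut_multiTensorPower]
    exact (isState_tensorPower (hρ.cut ∅) n).submatrix _
  rw [cut_eq_submatrix] at h
  have h' := h.submatrix (Equiv.piEquivPiSubtypeProd (· ∈ (∅ : Finset ι)) fun p => Fin n → X p)
  simpa only [Matrix.submatrix_submatrix, Equiv.symm_comp_self, Matrix.submatrix_id_id] using h'

theorem relEntEntanglement_cut_multiTensorPower (T : Finset ι)
    {ρ : Matrix (∀ p, X p) (∀ p, X p) ℂ} (hρ : IsState ρ) (n : ℕ) :
    relEntEntanglement (cut T (multiTensorPower ρ n)) =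
      relEntEntanglement (tensorPower (cut T ρ) n) := by
  rw [cut_multiTensorPower, relEntEntanglement_submatrix (isState_tensorPower (hρ.cut T) n)]

theorem cutEntanglementPerCopy_eq (T : Finset ι) {ρ : Matrix (∀ p, X p) (∀ p, X p) ℂ}
    (hρ : IsState ρ) : cutEntanglementPerCopy T ρ = entanglementPerCopy (cut T ρ) := by
  ext n
  rw [cutEntanglementPerCopy, cutRelEnt, relEntEntanglement_cut_multiTensorPower T hρ,
    entanglementPerCopy]

theorem cutRegRelEnt_eq (T : Finset ι) {ρ : Matrix (∀ p, X p) (∀ p, X p) ℂ}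
    (hρ : IsState ρ) : cutRegRelEnt T ρ = regRelEnt (cut T ρ) := by
  rw [cutRegRelEnt, cutEntanglementPerCopy_eq T hρ, regRelEnt]

theorem cutRegRelEnt_exists_nonneg_lt_top (T : Finset ι) {ρ : Matrix (∀ p, X p) (∀ p, X p) ℂ}
    (hρ : IsState ρ) :
    Tendsto (cutEntanglementPerCopy T ρ) atTop (𝓝 (cutRegRelEnt T ρ)) ∧
      0 ≤ cutRegRelEnt T ρ ∧ cutRegRelEnt T ρ < ⊤ := by
  rw [cutRegRelEnt_eq T hρ, cutEntanglementPerCopy_eq T hρ]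
  exact regRelEnt_exists_nonneg_lt_top (hρ.cut T)

theorem multiRate_le {ρ : Matrix (∀ p, X p) (∀ p, X p) ℂ} {σ : Matrix (∀ p, Y p) (∀ p, Y p) ℂ}
    (hρ : IsState ρ) (hσ : IsState σ) {T : Finset ι} (hT : T.Nonempty) (hT' : T ≠ Finset.univ)
    (hpos : 0 < cutRegRelEnt T σ) :
    multiRate ρ σ ≤ cutRegRelEnt T ρ / cutRegRelEnt T σ := by
  rw [cutRegRelEnt_eq T hσ] at hpos ⊢
  rw [cutRegRelEnt_eq T hρ]
  obtain ⟨L, hL, hu, -, hLeq⟩ := exists_regRelEnt (hρ.cut T)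
  obtain ⟨K, hK, hv, -, hKeq⟩ := exists_regRelEnt (hσ.cut T)
  rw [hKeq] at hpos
  have hK0 : 0 < K := by exact_mod_cast hpos
  rw [hLeq, hKeq]
  refine iSup₂_le fun r hr => coe_le_div_of_mul_le hK0 ?_
  obtain ⟨Λ, hΛ, h⟩ := hr
  have := (hσ.cut T).nonempty
  refine mul_le_of_frequently_le hL (logb_card_nonneg
    (A := (∀ p : {p // p ∈ T}, Y p) × (∀ p : {p // p ∉ T}, Y p))) hu hv ?_
  intro δ hδ hδ1 N
  obtain ⟨n, hn, h1, h2⟩ := h 1 one_pos δ hδ N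
  refine ⟨n, hn, ?_⟩
  have hρn := isState_multiTensorPower hρ n
  have hσn := isState_multiTensorPower hσ ⌊r * n⌋₊
  have hω := (hΛ n).isState hρn
  have h3 := entReal_le_add_of_relEntEntanglement_le (hρn.cut T) (hω.cut T) (h1 T hT hT' _ hρn)
  have h4 := entReal_le_of_traceNorm_le (hω.cut T) (hσn.cut T) hδ1
    ((traceNorm_cut T (Λ n (multiTensorPower ρ n) - multiTensorPower σ ⌊r * n⌋₊)).trans_le h2.le)
  have h5 : entReal (cut T (multiTensorPower ρ n)) = entReal (tensorPower (cut T ρ) n) :=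
    congrArg EReal.toReal (relEntEntanglement_cut_multiTensorPower T hρ n)
  have h6 : entReal (cut T (multiTensorPower σ ⌊r * n⌋₊)) =
      entReal (tensorPower (cut T σ) ⌊r * n⌋₊) :=
    congrArg EReal.toReal (relEntEntanglement_cut_multiTensorPower T hσ _)
  have h7 : Fintype.card ((∀ p : {p // p ∈ T}, Fin ⌊r * n⌋₊ → Y p) ×
      (∀ p : {p // p ∉ T}, Fin ⌊r * n⌋₊ → Y p)) =
      Fintype.card ((Fin ⌊r * n⌋₊ → ∀ p : {p // p ∈ T}, Y p) ×
        (Fin ⌊r * n⌋₊ → ∀ p : {p // p ∉ T}, Y p)) :=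
    Fintype.card_congr ((Equiv.piComm _).prodCongr (Equiv.piComm _))
  rw [h6, h7, tensorPower_card_logb] at h4
  rw [h5] at h3
  linarith

end Multipartite

/-! ### Overlap of separable states with maximally entangled vectors. -/

section MaxEntangled

variable {A B : Type*} [Fintype A] [DecidableEq A] [Fintype B] [DecidableEq B]

theorem trace_mul_le {P Q : Matrix A A ℂ} (hP : P.PosSemidef) (hQ : Q.PosSemidef) :
    (P * Q).trace.re ≤ P.trace.re * Q.trace.re := by
  obtain ⟨U, hU, μ, hμ, rfl⟩ := exists_conjDiag_of_posSemidef hQ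
  rw [trace_mul_conjDiag, trace_conjDiag hU, Complex.re_sum, ← sum_weight hU P, Finset.mul_sum]
  refine Finset.sum_le_sum fun j _ => ?_
  rw [Complex.ofReal_re, mul_comm]
  exact mul_le_mul_of_nonneg_right (Finset.single_le_sum (f := weight U P)
    (fun i _ => weight_nonneg U hP i) (Finset.mem_univ j)) (hμ j)

/-- Overlap of a product state with a vector of the form `∑ a, c a • |a⟩ ⊗ |f a⟩` whose
coefficients have constant modulus. -/
theorem trace_vecMulVec_mul_kronecker_le {α : Matrix A A ℂ} {β : Matrix B B ℂ} (hα : IsState α)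
    (hβ : IsState β) (f : A ≃ B) (c : A → ℂ) {κ : ℝ} (hc : ∀ a, Complex.normSq (c a) = κ)
    {ψ : A × B → ℂ} (hψ : ∀ x, ψ x = if x.2 = f x.1 then c x.1 else 0) :
    (Matrix.vecMulVec ψ (star ψ) * α ⊗ₖ β).trace.re ≤ κ := by
  -- `γ` is `β` transported to the first party along `f` and twisted by the coefficients. The
  -- overlap equals `Tr(α γᵀ)`, hence is at most `Tr α · Tr γ = κ`.
  set γ : Matrix A A ℂ := (Matrix.diagonal c)ᴴ * β.submatrix f f * Matrix.diagonal c with hγ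
  have hγapp : ∀ a a', γ a a' = star (c a) * β (f a) (f a') * c a' := by
    intro a a'
    rw [hγ, Matrix.diagonal_conjTranspose, Matrix.mul_diagonal, Matrix.diagonal_mul]
    rfl
  have hγpsd : γ.PosSemidef := (hβ.submatrix f).1.conjTranspose_mul_mul_same _
  have hγtr : γ.trace.re = κ := by
    have h1 : γ.trace = (κ : ℂ) * (β.submatrix f f).trace := by
      rw [Matrix.trace, Matrix.trace, Finset.mul_sum]
      refine Finset.sum_congr rfl fun a _ => ?_
      rw [Matrix.diag_apply, hγapp, ← hc a, Complex.normSq_eq_conj_mul_self, Complex.star_def]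
      simp only [Matrix.diag_apply, Matrix.submatrix_apply]
      ring
    rw [h1, (hβ.submatrix f).2, mul_one, Complex.ofReal_re]
  have hmain : (Matrix.vecMulVec ψ (star ψ) * α ⊗ₖ β).trace = (α * γᵀ).trace := by
    have h1 : (Matrix.vecMulVec ψ (star ψ) * α ⊗ₖ β).trace =
        ∑ x, ∑ y, ψ x * star (ψ y) * (α y.1 x.1 * β y.2 x.2) := by
      rw [Matrix.trace]
      rfl
    have h2 : (α * γᵀ).trace = ∑ a', ∑ a, α a' a * γ a' a := rfl
    rw [h1, h2, Finset.sum_comm]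
    simp only [Fintype.sum_prod_type, hψ, hγapp]
    refine Finset.sum_congr rfl fun a' _ => ?_
    rw [Finset.sum_eq_single (f a') (fun b _ hb => by simp [hb]) (by simp)]
    refine Finset.sum_congr rfl fun a _ => ?_
    rw [Finset.sum_eq_single (f a) (fun b _ hb => by simp [hb]) (by simp)]
    simp only [if_true]
    ring
  rw [hmain]
  refine (trace_mul_le hα.1 hγpsd.transpose).trans_eq ?_
  rw [hα.trace_re, one_mul, Matrix.trace_transpose, hγtr]

theorem vecMulVec_mul_self_of_isState {ψ : A → ℂ}
    (h : IsState (Matrix.vecMulVec ψ (star ψ))) :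
    Matrix.vecMulVec ψ (star ψ) * Matrix.vecMulVec ψ (star ψ) = Matrix.vecMulVec ψ (star ψ) := by
  have h1 : star ψ ⬝ᵥ ψ = 1 := by
    rw [dotProduct_comm, ← Matrix.trace_vecMulVec, h.2]
  rw [Matrix.vecMulVec_mul_vecMulVec, h1, one_smul]

/-- A pure state has zero entropy, so the relative entropy to `σ` is `-Tr(ψ log σ) ≥ -log Tr(ψ σ)`,
and the overlap with a separable `σ` is at most `κ`. -/
theorem neg_logb_le_entReal {ψ : A × B → ℂ} (h : IsState (Matrix.vecMulVec ψ (star ψ)))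
    (f : A ≃ B) (c : A → ℂ) {κ : ℝ} (hκ : 0 < κ) (hc : ∀ a, Complex.normSq (c a) = κ)
    (hψ : ∀ x, ψ x = if x.2 = f x.1 then c x.1 else 0) :
    -Real.logb 2 κ ≤ entReal (Matrix.vecMulVec ψ (star ψ)) := by
  refine le_entReal h fun σ hσ hsup => ?_
  have h1 : (Matrix.vecMulVec ψ (star ψ) * σ).trace.re ≤ κ := by
    refine hσ.of_convex
      (S := {σ | (Matrix.vecMulVec ψ (star ψ) * σ).trace.re ≤ κ}) ?_ ?_
    · intro σ hσ τ hτ s t hs ht hst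
      rw [Set.mem_ofPred_eq] at hσ hτ ⊢
      rw [Matrix.mul_add, Matrix.mul_smul, Matrix.mul_smul, Matrix.trace_add, Matrix.trace_smul,
        Matrix.trace_smul, Complex.add_re, Complex.smul_re, Complex.smul_re]
      exact (convex_Iic κ) hσ hτ hs ht hst
    · intro α β hα hβ
      exact trace_vecMulVec_mul_kronecker_le hα hβ f c hc hψ
  have h2 := crossLog_le_of_trace_mul_le h.1 hσ.isState.1 hsup h.trace_re hκ h1
  rw [crossLog_self_of_mul_self h.1 (vecMulVec_mul_self_of_isState h)]
  linarith

end MaxEntangled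

/-! ### The singlet has at least one bit of entanglement per copy. -/

section Singlet

/-- Schmidt form of the singlet: the matching between the two parties is the bit flip `Fin.revPerm`.
-/
theorem singletVec_eq (x : Fin 2 × Fin 2) :
    singletVec x = if x.2 = Fin.revPerm x.1 then singletVec (x.1, Fin.revPerm x.1) else 0 := by
  obtain ⟨i, j⟩ := x
  fin_cases i <;> fin_cases j <;> simp [singletVec]

theorem normSq_singletVec (i : Fin 2) :
    Complex.normSq (singletVec (i, Fin.revPerm i)) = 2⁻¹ := by
  fin_cases i <;> simp [singletVec]

theorem isState_singlet : IsState singlet := by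
  refine ⟨Matrix.posSemidef_vecMulVec_self_star _, ?_⟩
  rw [singlet, Matrix.trace_vecMulVec, dotProduct_comm, dotProduct, Fintype.sum_prod_type]
  have key : ∀ x, star singletVec x * singletVec x = (Complex.normSq (singletVec x) : ℂ) :=
    fun x => (Complex.normSq_eq_conj_mul_self).symm
  simp only [key, Fin.sum_univ_two]
  have h0 : singletVec (0, 0) = 0 := by simp [singletVec]
  have h1 : singletVec (1, 1) = 0 := by simp [singletVec]
  have h2 : Complex.normSq (singletVec (0, 1)) = 2⁻¹ := normSq_singletVec 0
  have h3 : Complex.normSq (singletVec (1, 0)) = 2⁻¹ := normSq_singletVec 1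
  rw [h0, h1, h2, h3]
  norm_num

theorem natCast_le_entReal_singlet (n : ℕ) : (n : ℝ) ≤ entReal (tensorPower singlet n) := by
  have hst := isState_tensorPower isState_singlet n
  let ψ : (Fin n → Fin 2) × (Fin n → Fin 2) → ℂ := fun x => ∏ k, singletVec (x.1 k, x.2 k)
  have heq : tensorPower singlet n = Matrix.vecMulVec ψ (star ψ) := by
    ext x y
    simp [tensorPower, singlet, Matrix.vecMulVec_apply, ψ, Finset.prod_mul_distrib]
  rw [heq] at hst ⊢
  -- The `n` singlets together are again in Schmidt form, with coordinatewise bit flip and `2ⁿ`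
  -- coefficients of squared modulus `2⁻ⁿ`.
  have h := neg_logb_le_entReal hst
    (Equiv.piCongrRight fun _ : Fin n => (Fin.revPerm : Equiv.Perm (Fin 2)))
    (fun a => ∏ k, singletVec (a k, Fin.revPerm (a k))) (κ := (2⁻¹ : ℝ) ^ n) (by positivity) ?_ ?_
  · rw [Real.logb_pow, Real.logb_inv, Real.logb_self_eq_one (by norm_num)] at h
    linarith
  · intro a
    rw [map_prod]
    simp only [normSq_singletVec, Finset.prod_const, Finset.card_univ, Fintype.card_fin]
  · intro x
    simp only [ψ]
    rw [Finset.prod_congr rfl fun k _ => singletVec_eq (x.1 k, x.2 k), Finset.prod_ite_zero]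
    simp [funext_iff]

theorem rate_singlet_le {A B : Type*} [Fintype A] [DecidableEq A] [Fintype B] [DecidableEq B]
    {ρ : Matrix (A × B) (A × B) ℂ} (hρ : IsState ρ) : rate ρ singlet ≤ regRelEnt ρ := by
  obtain ⟨L, hL, -, -, hLeq⟩ := exists_regRelEnt hρ
  obtain ⟨K, -, hK, -, hKeq⟩ := exists_regRelEnt isState_singlet
  have hK1 : 1 ≤ K := by
    refine ge_of_tendsto hK ?_
    filter_upwards [eventually_gt_atTop 0] with n hn
    rw [one_le_div (by exact_mod_cast hn)]
    exact natCast_le_entReal_singlet n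
  have hpos : 0 < regRelEnt singlet := by
    rw [hKeq]
    exact_mod_cast one_pos.trans_le hK1
  refine (rate_le hρ isState_singlet hpos).trans ?_
  rw [hLeq, hKeq, ← EReal.coe_div, EReal.coe_le_coe_iff]
  exact div_le_self hL hK1

end Singlet

end AEN

theorem mainTheorem3 :
    -- the limit defining `E_∞` exists, and is nonnegative and finite
    (∀ (A B : Type*) [Fintype A] [DecidableEq A] [Fintype B] [DecidableEq B]
      (ρ : Matrix (A × B) (A × B) ℂ), AEN.IsState ρ →
        Tendsto (AEN.entanglementPerCopy ρ) atTop (𝓝 (AEN.regRelEnt ρ)) ∧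
        0 ≤ AEN.regRelEnt ρ ∧ AEN.regRelEnt ρ < ⊤) ∧
    -- the bipartite bound
    (∀ (A B A' B' : Type*) [Fintype A] [DecidableEq A] [Fintype B] [DecidableEq B]
      [Fintype A'] [DecidableEq A'] [Fintype B'] [DecidableEq B']
      (ρ : Matrix (A × B) (A × B) ℂ) (σ : Matrix (A' × B') (A' × B') ℂ),
      AEN.IsState ρ → AEN.IsState σ → 0 < AEN.regRelEnt σ →
        AEN.rate ρ σ ≤ AEN.regRelEnt ρ / AEN.regRelEnt σ) ∧
    -- the singlet distillation rate is bounded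
    (∀ (A B : Type*) [Fintype A] [DecidableEq A] [Fintype B] [DecidableEq B]
      (ρ : Matrix (A × B) (A × B) ℂ), AEN.IsState ρ →
        AEN.rate ρ AEN.singlet ≤ AEN.regRelEnt ρ) ∧
    -- the multipartite bound
    (∀ (ι : Type*) [Fintype ι] [DecidableEq ι]
      (X : ι → Type*) [∀ p, Fintype (X p)] [∀ p, DecidableEq (X p)]
      (Y : ι → Type*) [∀ p, Fintype (Y p)] [∀ p, DecidableEq (Y p)]
      (ρ : Matrix (∀ p, X p) (∀ p, X p) ℂ) (σ : Matrix (∀ p, Y p) (∀ p, Y p) ℂ),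
      AEN.IsState ρ → AEN.IsState σ →
        (∀ T : Finset ι, T.Nonempty → T ≠ Finset.univ →
          (Tendsto (AEN.cutEntanglementPerCopy T ρ) atTop (𝓝 (AEN.cutRegRelEnt T ρ)) ∧
            0 ≤ AEN.cutRegRelEnt T ρ ∧ AEN.cutRegRelEnt T ρ < ⊤) ∧
          (Tendsto (AEN.cutEntanglementPerCopy T σ) atTop (𝓝 (AEN.cutRegRelEnt T σ)) ∧
            0 ≤ AEN.cutRegRelEnt T σ ∧ AEN.cutRegRelEnt T σ < ⊤)) ∧
        AEN.multiRate ρ σ ≤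
          ⨅ (T : Finset ι) (_ : T.Nonempty ∧ T ≠ Finset.univ ∧ 0 < AEN.cutRegRelEnt T σ),
            AEN.cutRegRelEnt T ρ / AEN.cutRegRelEnt T σ) := by
  refine ⟨fun A B _ _ _ _ ρ hρ => AEN.regRelEnt_exists_nonneg_lt_top hρ,
    fun A B A' B' _ _ _ _ _ _ _ _ ρ σ hρ hσ hpos => AEN.rate_le hρ hσ hpos,
    fun A B _ _ _ _ ρ hρ => AEN.rate_singlet_le hρ,
    fun ι _ _ X _ _ Y _ _ ρ σ hρ hσ => ⟨fun T _ _ =>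
      ⟨AEN.cutRegRelEnt_exists_nonneg_lt_top T hρ, AEN.cutRegRelEnt_exists_nonneg_lt_top T hσ⟩,
      le_iInf₂ fun T hT => AEN.multiRate_le hρ hσ hT.1 hT.2.1 hT.2.2⟩⟩
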